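/- Let $\mathbb F$ be a field of characteristic $0$, let $n\ge 2$, and let $1\le n_1\le n_2\le n$ be integers. On $\mathscr B=\mathbb F[x_1,\dots,x_n,y_1,\dots,y_n]$ let $\mathfrak{sl}(n,\mathbb F)$ act by $\sum_{i,j} a_{ij}E_{i,j}\mapsto \sum_{i,j} a_{ij}\,(E^x_{i,j}-E^y_{j,i})$, where $$E^x_{i,j}=\begin{cases}-x_j\partial_{x_i}-\delta_{i,j}& i,j\le n_1\\ \partial_{x_i}\partial_{x_j}& i\le n_1<j\\ -x_ix_j& j\le n_1<i\\ x_i\partial_{x_j}& i,j>n_1\end{cases}\qquad E^y_{i,j}=\begin{cases}y_i\partial_{y_j}& i,j\le n_2\\ -y_iy_j& i\le n_2<j\\ \partial_{y_i}\partial_{y_j}& j\le n_2<i\\ -y_j\partial_{y_i}-\delta_{i,j}& i,j>n_2.\end{cases}$$ Put $$\mathscr D=-\sum_{i=1}^{n_1}x_i\partial_{y_i}+\sum_{r=n_1+1}^{n_2}\partial_{x_r}\partial_{y_r}-\sum_{s=n_2+1}^n y_s\partial_{x_s}.$$ For $\ell_1,\ell_2\in\mathbb Z$ let $\mathscr B_{\langle\ell_1,\ell_2\rangle}$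 be the span of the monomials $x^\alpha y^\beta$ with $\sum_{r>n_1}\alpha_r-\sum_{i\le n_1}\alpha_i=\ell_1$ and $\sum_{i\le n_2}\beta_i-\sum_{r>n_2}\beta_r=\ell_2$, and let $\mathscr H_{\langle\ell_1,\ell_2\rangle}=\{f\in\mathscr B_{\langle\ell_1,\ell_2\rangle}\mid\mathscr D(f)=0\}$, which is an $\mathfrak{sl}(n,\mathbb F)$-submodule of $\mathscr B$. For a module $M$ over an algebra $A$, where $A$ is generated by a finite-dimensional subspace $V$ and $M$ is generated by a finite-dimensional subspace $M_0$, the Gelfand–Kirillov dimension of $M$ is $\limsup_{k\to\infty}\log\dim(V^kM_0)/\log k$, where $V^k$ is the span of all products of at most $k$ elements of $V$. The Gelfand–Kirillov dimension of an $\mathfrak{sl}(n,\mathbb F)$-module is that of the corresponding module over the universal enveloping algebra $U(\mathfrak{sl}(n,\mathbb F))$. **Statement.** Suppose that the $\mathfrak{sl}(n,\mathbb F)$-module $\mathscr H_{\langle\ell_1,\ell_2\rangle}$ is irreducible. Then, for any choice of finite-dimensional generating subspaces $V$ of $U(\mathfrak{sl}(n,\mathbb F))$ and $M_0$ of $\mathscr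 H_{\langle\ell_1,\ell_2\rangle}$, the module $\mathscr H_{\langle\ell_1,\ell_2\rangle}$ has Gelfand–Kirillov dimension $n-1$ (the value called the minimal Gelfand–Kirillov dimension) if and only if one of the following holds: 1. $n_1<n_2=n$; 2. $n_1=n_2=1$; 3. $n_1=n_2=n-1$. -/

import Mathlib

open MvPolynomial

noncomputable section

namespace Oscillator

/-! ### Gelfand–Kirillov dimension of a module

A left module `M` over an associative algebra `A` is given by its structure map
`φ : A →ₐ[F] Module.End F M`. -/

section GK

variable {F A M : Type*} [Field F] [Ring A] [Algebra F A] [AddCommGroup M] [Module F M]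

/-- The linear span of all products of length at most `k` in elements of `V`
(the empty product `1` included). -/
def productsUpTo (V : Submodule F A) (k : ℕ) : Submodule F A :=
  ⨆ j : Fin (k + 1), V ^ (j : ℕ)

/-- For a subspace `W` of `A` and a subspace `M₀` of `M`, the subspace `W M₀`, i.e. the span of
all `w m` with `w ∈ W` and `m ∈ M₀`. -/
def actOn (φ : A →ₐ[F] Module.End F M) (W : Submodule F A) (M₀ : Submodule F M) :
    Submodule F M :=
  Submodule.map₂ φ.toLinearMap W M₀

/-- `V` is a finite-dimensional subspace generating the algebra `A`. -/
def IsGeneratingSpace (V : Submodule F A) : Prop :=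
  FiniteDimensional F V ∧ Algebra.adjoin F (V : Set A) = ⊤

/-- `M₀` is a finite-dimensional subspace generating the `A`-module `M`. -/
def IsModuleGeneratingSpace (φ : A →ₐ[F] Module.End F M) (M₀ : Submodule F M) : Prop :=
  FiniteDimensional F M₀ ∧ actOn φ ⊤ M₀ = ⊤

/-- `limsup_{k → ∞} log dim (V^k M₀) / log k`, as an extended real number. For generating spaces
`V` and `M₀` this is the Gelfand–Kirillov dimension of `M`. -/
def gkDim (φ : A →ₐ[F] Module.End F M) (V : Submodule F A) (M₀ : Submodule F M) : EReal :=
  Filter.limsup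
    (fun k : ℕ =>
      ((Real.log (Module.finrank F (actOn φ (productsUpTo V k) M₀)) / Real.log k : ℝ) : EReal))
    Filter.atTop

end GK

/-! ### The oscillator representation -/

section Osc

variable (F : Type*) [Field F] (n n₁ n₂ : ℕ)

/-- The polynomial algebra `F[x₁,…,xₙ,y₁,…,yₙ]`; `Sum.inl i` indexes `x`, `Sum.inr i` indexes `y`.
Indices run over `Fin n`, so that an index `i` belongs to the first `m` ones iff `(i : ℕ) < m`. -/
def Poly : Type _ := MvPolynomial (Fin n ⊕ Fin n) F

instance : AddCommGroup (Poly F n) :=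
  inferInstanceAs (AddCommGroup (MvPolynomial (Fin n ⊕ Fin n) F))
instance : Module F (Poly F n) := inferInstanceAs (Module F (MvPolynomial (Fin n ⊕ Fin n) F))

variable {n}

/-- The monomial with exponents `d`. -/
def mon (d : (Fin n ⊕ Fin n) →₀ ℕ) : Poly F n :=
  (monomial d 1 : MvPolynomial (Fin n ⊕ Fin n) F)

/-- Multiplication by the variable `v`. -/
def mulX (v : Fin n ⊕ Fin n) : Module.End F (Poly F n) :=
  (LinearMap.mulLeft F (X v) :
    MvPolynomial (Fin n ⊕ Fin n) F →ₗ[F] MvPolynomial (Fin n ⊕ Fin n) F)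

/-- Partial derivative in the variable `v`. -/
def del (v : Fin n ⊕ Fin n) : Module.End F (Poly F n) :=
  ((pderiv v).toLinearMap :
    MvPolynomial (Fin n ⊕ Fin n) F →ₗ[F] MvPolynomial (Fin n ⊕ Fin n) F)

/-- Multiplication by `x_i`. -/
abbrev x (i : Fin n) : Module.End F (Poly F n) := mulX F (Sum.inl i)
/-- Multiplication by `y_i`. -/
abbrev y (i : Fin n) : Module.End F (Poly F n) := mulX F (Sum.inr i)
/-- The operator `∂/∂x_i`. -/
abbrev dx (i : Fin n) : Module.End F (Poly F n) := del F (Sum.inl i)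
/-- The operator `∂/∂y_i`. -/
abbrev dy (i : Fin n) : Module.End F (Poly F n) := del F (Sum.inr i)

/-- The operators `E_{i,j}^x` (products are compositions of operators). -/
def Ex (i j : Fin n) : Module.End F (Poly F n) :=
  if (i : ℕ) < n₁ then
    if (j : ℕ) < n₁ then -(x F j * dx F i) - (if i = j then 1 else 0) else dx F i * dx F j
  else
    if (j : ℕ) < n₁ then -(x F i * x F j) else x F i * dx F j

/-- The operators `E_{i,j}^y`. -/
def Ey (i j : Fin n) : Module.End F (Poly F n) :=
  if (i : ℕ) < n₂ then
    if (j : ℕ) < n₂ then y F i * dy F j else -(y F i * y F j)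
  else
    if (j : ℕ) < n₂ then dy F i * dy F j else -(y F j * dy F i) - (if i = j then 1 else 0)

/-- The operator by which the matrix unit `E_{i,j}` acts. -/
def E (i j : Fin n) : Module.End F (Poly F n) := Ex F n₁ i j - Ey F n₂ j i

variable (n)

/-- The deformed Laplace operator
`-∑_{i ≤ n₁} x_i ∂_{y_i} + ∑_{n₁ < r ≤ n₂} ∂_{x_r} ∂_{y_r} - ∑_{s > n₂} y_s ∂_{x_s}`. -/
def laplace : Module.End F (Poly F n) :=
  -(∑ i ∈ Finset.univ.filter (fun i : Fin n => (i : ℕ) < n₁), x F i * dy F i)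
    + (∑ r ∈ Finset.univ.filter (fun r : Fin n => n₁ ≤ (r : ℕ) ∧ (r : ℕ) < n₂), dx F r * dy F r)
    - ∑ s ∈ Finset.univ.filter (fun s : Fin n => n₂ ≤ (s : ℕ)), y F s * dx F s

variable {n}

/-- The first degree `∑_{r > n₁} α_r - ∑_{i ≤ n₁} α_i` of the monomial `x^α y^β`, where
`d = (α, β)`. -/
def deg₁ (d : (Fin n ⊕ Fin n) →₀ ℕ) : ℤ :=
  (∑ r ∈ Finset.univ.filter (fun r : Fin n => n₁ ≤ (r : ℕ)), (d (Sum.inl r) : ℤ))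
    - ∑ i ∈ Finset.univ.filter (fun i : Fin n => (i : ℕ) < n₁), (d (Sum.inl i) : ℤ)

/-- The second degree `∑_{i ≤ n₂} β_i - ∑_{r > n₂} β_r` of the monomial `x^α y^β`, where
`d = (α, β)`. -/
def deg₂ (d : (Fin n ⊕ Fin n) →₀ ℕ) : ℤ :=
  (∑ i ∈ Finset.univ.filter (fun i : Fin n => (i : ℕ) < n₂), (d (Sum.inr i) : ℤ))
    - ∑ r ∈ Finset.univ.filter (fun r : Fin n => n₂ ≤ (r : ℕ)), (d (Sum.inr r) : ℤ)

variable (n)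

/-- The homogeneous space `B_{⟨ℓ₁,ℓ₂⟩}`, spanned by the monomials of bidegree `(ℓ₁, ℓ₂)`. -/
def bigraded (l₁ l₂ : ℤ) : Submodule F (Poly F n) :=
  Submodule.span F {f | ∃ d : (Fin n ⊕ Fin n) →₀ ℕ,
    deg₁ n₁ d = l₁ ∧ deg₂ n₂ d = l₂ ∧ f = mon F d}

/-! Auxiliary facts: the operators define a representation preserving the solution spaces. -/

variable {n}

theorem del_mulX (v w : Fin n ⊕ Fin n) :
    del F v * mulX F w = mulX F w * del F v + if v = w then 1 else 0 := by
  refine LinearMap.ext fun f => ?_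
  by_cases h : v = w
  · subst h
    rw [if_pos rfl]
    have h1 : ∀ g : MvPolynomial (Fin n ⊕ Fin n) F,
        pderiv v (X v * g) = X v * pderiv v g + g := fun g => by
      rw [Derivation.leibniz, pderiv_X_self, smul_eq_mul, smul_eq_mul, mul_one]
    exact h1 f
  · rw [if_neg h, add_zero]
    have h1 : ∀ g : MvPolynomial (Fin n ⊕ Fin n) F,
        pderiv v (X w * g) = X w * pderiv v g := fun g => by
      rw [Derivation.leibniz, pderiv_X_of_ne (Ne.symm h), smul_eq_mul, smul_zero, add_zero]
    exact h1 f

theorem mulX_comm (v w : Fin n ⊕ Fin n) : mulX F v * mulX F w = mulX F w * mulX F v := by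
  refine LinearMap.ext fun f => ?_
  have h1 : ∀ g : MvPolynomial (Fin n ⊕ Fin n) F, X v * (X w * g) = X w * (X v * g) :=
    fun g => mul_left_comm _ _ _
  exact h1 f

theorem del_comm (v w : Fin n ⊕ Fin n) : del F v * del F w = del F w * del F v := by
  refine LinearMap.ext fun f => ?_
  have h : ⁅(pderiv v : Derivation F (MvPolynomial (Fin n ⊕ Fin n) F)
      (MvPolynomial (Fin n ⊕ Fin n) F)), (pderiv w : Derivation F
      (MvPolynomial (Fin n ⊕ Fin n) F) (MvPolynomial (Fin n ⊕ Fin n) F))⁆ = 0 := by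
    refine MvPolynomial.derivation_ext fun i => ?_
    rw [Derivation.commutator_apply]
    simp only [pderiv_X, Pi.single_apply]
    split_ifs <;> simp
  have h2 : ∀ g : MvPolynomial (Fin n ⊕ Fin n) F,
      pderiv v (pderiv w g) = pderiv w (pderiv v g) := fun g => by
    rw [← sub_eq_zero, ← Derivation.commutator_apply, h, Derivation.zero_apply]
  exact h2 f

/-- Whether the roles of a variable and of its derivative are exchanged. -/
def swapped : Fin n ⊕ Fin n → Prop
  | Sum.inl i => (i : ℕ) < n₁
  | Sum.inr i => ¬ (i : ℕ) < n₂

open Classical in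
/-- The operator substituted for the variable `v`. -/
def Q (v : Fin n ⊕ Fin n) : Module.End F (Poly F n) :=
  if swapped n₁ n₂ v then del F v else mulX F v

open Classical in
/-- The operator substituted for the partial derivative in `v`. -/
def P (v : Fin n ⊕ Fin n) : Module.End F (Poly F n) :=
  if swapped n₁ n₂ v then -mulX F v else del F v

theorem P_Q (v w : Fin n ⊕ Fin n) :
    P F n₁ n₂ v * Q F n₁ n₂ w = Q F n₁ n₂ w * P F n₁ n₂ v + if v = w then 1 else 0 := by
  by_cases hvw : v = w
  · subst hvw
    rw [if_pos rfl]
    unfold P Q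
    split_ifs
    · rw [mul_neg, del_mulX, if_pos rfl, neg_mul]
      abel
    · rw [del_mulX, if_pos rfl]
  · rw [if_neg hvw, add_zero]
    unfold P Q
    split_ifs
    · rw [mul_neg, neg_mul, del_mulX, if_neg (Ne.symm hvw), add_zero]
    · rw [mul_neg, neg_mul, mulX_comm]
    · rw [del_comm]
    · rw [del_mulX, if_neg hvw, add_zero]

theorem P_P (v w : Fin n ⊕ Fin n) :
    P F n₁ n₂ v * P F n₁ n₂ w = P F n₁ n₂ w * P F n₁ n₂ v := by
  by_cases hvw : v = w
  · rw [hvw]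
  · unfold P
    split_ifs
    · rw [neg_mul_neg, neg_mul_neg, mulX_comm]
    · rw [mul_neg, neg_mul, del_mulX, if_neg (Ne.symm hvw), add_zero]
    · rw [mul_neg, neg_mul, del_mulX, if_neg hvw, add_zero]
    · rw [del_comm]

theorem Q_Q (v w : Fin n ⊕ Fin n) :
    Q F n₁ n₂ v * Q F n₁ n₂ w = Q F n₁ n₂ w * Q F n₁ n₂ v := by
  by_cases hvw : v = w
  · rw [hvw]
  · unfold Q
    split_ifs
    · rw [del_comm]
    · rw [del_mulX, if_neg hvw, add_zero]
    · rw [del_mulX, if_neg (Ne.symm hvw), add_zero]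
    · rw [mulX_comm]

theorem Ex_eq (i j : Fin n) :
    Ex F n₁ i j = Q F n₁ n₂ (Sum.inl i) * P F n₁ n₂ (Sum.inl j) := by
  unfold Ex Q P swapped
  dsimp only
  split_ifs with h1 h2 h3 h3
  · subst h3
    rw [mul_neg, del_mulX, if_pos rfl]
    abel
  · have h : (Sum.inl i : Fin n ⊕ Fin n) ≠ Sum.inl j := fun h => h3 (Sum.inl.inj h)
    rw [mul_neg, del_mulX, if_neg h]
    abel
  · rfl
  · rw [mul_neg]
  · rfl

theorem Ey_eq (i j : Fin n) :
    Ey F n₂ i j = Q F n₁ n₂ (Sum.inr i) * P F n₁ n₂ (Sum.inr j) := by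
  unfold Ey Q P swapped
  dsimp only
  by_cases h1 : (i : ℕ) < n₂ <;> by_cases h2 : (j : ℕ) < n₂
  · simp only [h1, h2, if_true, not_true_eq_false, if_false]
  · simp only [h1, h2, if_true, not_true_eq_false, not_false_eq_true, if_false, mul_neg]
  · simp only [h1, h2, if_true, not_true_eq_false, not_false_eq_true, if_false]
  · simp only [h1, h2, if_true, not_false_eq_true, if_false]
    rw [mul_neg, del_mulX]
    simp only [Sum.inr.injEq]
    abel

theorem laplace_eq (h : n₁ ≤ n₂) :
    laplace F n n₁ n₂ = ∑ i, P F n₁ n₂ (Sum.inl i) * P F n₁ n₂ (Sum.inr i) := by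
  unfold laplace P swapped
  dsimp only
  rw [Finset.sum_filter, Finset.sum_filter, Finset.sum_filter, ← Finset.sum_neg_distrib,
    ← Finset.sum_add_distrib, ← Finset.sum_sub_distrib]
  refine Finset.sum_congr rfl fun i _ => ?_
  by_cases h1 : (i : ℕ) < n₁
  · have h2 : (i : ℕ) < n₂ := lt_of_lt_of_le h1 h
    simp [h1, h2, not_le.mpr h1, not_le.mpr h2]
  · by_cases h2 : (i : ℕ) < n₂
    · simp [h1, h2, not_lt.mp h1, not_le.mpr h2]
    · simp only [h1, h2, not_lt.mp h2, if_true, if_false, and_false, not_false_eq_true, neg_zero,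
        zero_add, zero_sub, mul_neg]
      rw [del_mulX, if_neg (by simp), add_zero]

theorem E_eq (i j : Fin n) :
    E F n₁ n₂ i j = Q F n₁ n₂ (Sum.inl i) * P F n₁ n₂ (Sum.inl j)
      - Q F n₁ n₂ (Sum.inr j) * P F n₁ n₂ (Sum.inr i) := by
  rw [E, Ex_eq F n₁ n₂, Ey_eq F n₁ n₂]

/-- The commutator of two products `Q_a P_b` and `Q_c P_d`. -/
theorem QP_comm (a b c d : Fin n ⊕ Fin n) :
    (Q F n₁ n₂ a * P F n₁ n₂ b) * (Q F n₁ n₂ c * P F n₁ n₂ d)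
      - (Q F n₁ n₂ c * P F n₁ n₂ d) * (Q F n₁ n₂ a * P F n₁ n₂ b)
    = (if b = c then Q F n₁ n₂ a * P F n₁ n₂ d else 0)
      - (if d = a then Q F n₁ n₂ c * P F n₁ n₂ b else 0) := by
  have e1 : (Q F n₁ n₂ a * P F n₁ n₂ b) * (Q F n₁ n₂ c * P F n₁ n₂ d)
      = Q F n₁ n₂ a * (P F n₁ n₂ b * Q F n₁ n₂ c) * P F n₁ n₂ d := by noncomm_ring
  have e2 : (Q F n₁ n₂ c * P F n₁ n₂ d) * (Q F n₁ n₂ a * P F n₁ n₂ b)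
      = Q F n₁ n₂ c * (P F n₁ n₂ d * Q F n₁ n₂ a) * P F n₁ n₂ b := by noncomm_ring
  have e3 : Q F n₁ n₂ a * (Q F n₁ n₂ c * P F n₁ n₂ b) * P F n₁ n₂ d
      = Q F n₁ n₂ c * (Q F n₁ n₂ a * P F n₁ n₂ d) * P F n₁ n₂ b := by
    calc _ = (Q F n₁ n₂ a * Q F n₁ n₂ c) * (P F n₁ n₂ b * P F n₁ n₂ d) := by noncomm_ring
      _ = (Q F n₁ n₂ c * Q F n₁ n₂ a) * (P F n₁ n₂ d * P F n₁ n₂ b) := by rw [Q_Q, P_P]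
      _ = _ := by noncomm_ring
  rw [e1, e2, P_Q, P_Q, mul_add, mul_add, add_mul, add_mul, e3]
  split_ifs <;> simp

theorem E_comm (i j k l : Fin n) :
    E F n₁ n₂ i j * E F n₁ n₂ k l - E F n₁ n₂ k l * E F n₁ n₂ i j
    = (if j = k then E F n₁ n₂ i l else 0) - (if l = i then E F n₁ n₂ k j else 0) := by
  simp only [E_eq]
  have h1 := QP_comm F n₁ n₂ (Sum.inl i) (Sum.inl j) (Sum.inl k) (Sum.inl l)
  have h2 := QP_comm F n₁ n₂ (Sum.inl i) (Sum.inl j) (Sum.inr l) (Sum.inr k)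
  have h3 := QP_comm F n₁ n₂ (Sum.inr j) (Sum.inr i) (Sum.inl k) (Sum.inl l)
  have h4 := QP_comm F n₁ n₂ (Sum.inr j) (Sum.inr i) (Sum.inr l) (Sum.inr k)
  simp only [Sum.inl.injEq, Sum.inr.injEq, reduceCtorEq, if_false, sub_zero] at h1 h2 h3 h4
  have h5 := congrArg₂ (· + ·) (congrArg₂ (· - ·) h1 h2) (congrArg₂ (· - ·) h4 h3)
  simp only [sub_mul, mul_sub]
  calc _ = _ := by abel
    _ = _ := h5
    _ = _ := by
      simp only [eq_comm (a := i) (b := l), eq_comm (a := k) (b := j)]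
      split_ifs <;> abel

theorem E_laplace (h : n₁ ≤ n₂) (i j : Fin n) :
    laplace F n n₁ n₂ * E F n₁ n₂ i j = E F n₁ n₂ i j * laplace F n n₁ n₂ := by
  rw [laplace_eq F n₁ n₂ h, E_eq, ← sub_eq_zero]
  have key : ∀ a b c d : Fin n ⊕ Fin n,
      (P F n₁ n₂ c * P F n₁ n₂ d) * (Q F n₁ n₂ a * P F n₁ n₂ b)
        - (Q F n₁ n₂ a * P F n₁ n₂ b) * (P F n₁ n₂ c * P F n₁ n₂ d)
      = (if c = a then P F n₁ n₂ d * P F n₁ n₂ b else 0)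
        + (if d = a then P F n₁ n₂ c * P F n₁ n₂ b else 0) := by
    intro a b c d
    have e1 : (P F n₁ n₂ c * P F n₁ n₂ d) * (Q F n₁ n₂ a * P F n₁ n₂ b)
        = P F n₁ n₂ c * (P F n₁ n₂ d * Q F n₁ n₂ a) * P F n₁ n₂ b := by noncomm_ring
    have e2 : P F n₁ n₂ c * (Q F n₁ n₂ a * P F n₁ n₂ d) * P F n₁ n₂ b
        = (P F n₁ n₂ c * Q F n₁ n₂ a) * (P F n₁ n₂ d * P F n₁ n₂ b) := by noncomm_ring
    have e3 : Q F n₁ n₂ a * P F n₁ n₂ c * (P F n₁ n₂ d * P F n₁ n₂ b)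
        = (Q F n₁ n₂ a * P F n₁ n₂ b) * (P F n₁ n₂ c * P F n₁ n₂ d) := by
      calc _ = Q F n₁ n₂ a * (P F n₁ n₂ c * (P F n₁ n₂ d * P F n₁ n₂ b)) := by noncomm_ring
        _ = Q F n₁ n₂ a * (P F n₁ n₂ b * (P F n₁ n₂ c * P F n₁ n₂ d)) := by
          rw [P_P F n₁ n₂ d b, ← mul_assoc (P F n₁ n₂ c), P_P F n₁ n₂ c b, mul_assoc]
        _ = _ := by noncomm_ring
    rw [e1, P_Q, mul_add, add_mul, e2, P_Q, add_mul, e3]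
    split_ifs <;> simp only [mul_one, one_mul, mul_zero, zero_mul, add_zero, zero_add] <;> abel
  have h1 : ∀ k : Fin n, _ := fun k =>
    key (Sum.inl i) (Sum.inl j) (Sum.inl k) (Sum.inr k)
  have h2 : ∀ k : Fin n, _ := fun k =>
    key (Sum.inr j) (Sum.inr i) (Sum.inl k) (Sum.inr k)
  simp only [Sum.inl.injEq, Sum.inr.injEq, reduceCtorEq, if_false, add_zero, zero_add] at h1 h2
  have e : ∀ S A B : Module.End F (Poly F n),
      S * (A - B) - (A - B) * S = (S * A - A * S) - (S * B - B * S) := by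
    intro S A B
    noncomm_ring
  rw [e]
  simp only [Finset.sum_mul, Finset.mul_sum, ← Finset.sum_sub_distrib, h1, h2]
  simp [P_P F n₁ n₂ (Sum.inr i) (Sum.inl j)]

theorem deg₁_add (d e : (Fin n ⊕ Fin n) →₀ ℕ) : deg₁ n₁ (d + e) = deg₁ n₁ d + deg₁ n₁ e := by
  simp only [deg₁, Finsupp.add_apply, Nat.cast_add, Finset.sum_add_distrib]
  ring

theorem deg₂_add (d e : (Fin n ⊕ Fin n) →₀ ℕ) : deg₂ n₂ (d + e) = deg₂ n₂ d + deg₂ n₂ e := by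
  simp only [deg₂, Finsupp.add_apply, Nat.cast_add, Finset.sum_add_distrib]
  ring

theorem deg₁_single (v : Fin n ⊕ Fin n) : deg₁ n₁ (Finsupp.single v 1) =
    match v with
    | Sum.inl i => if (i : ℕ) < n₁ then -1 else 1
    | Sum.inr _ => 0 := by
  rcases v with i | i
  · by_cases h : (i : ℕ) < n₁
    · simp [deg₁, Finsupp.single_apply, h]
    · simp [deg₁, Finsupp.single_apply, h, not_lt.mp h]
  · simp [deg₁]

theorem deg₂_single (v : Fin n ⊕ Fin n) : deg₂ n₂ (Finsupp.single v 1) =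
    match v with
    | Sum.inl _ => 0
    | Sum.inr i => if (i : ℕ) < n₂ then 1 else -1 := by
  rcases v with i | i
  · simp [deg₂]
  · by_cases h : (i : ℕ) < n₂
    · simp [deg₂, Finsupp.single_apply, h]
    · simp [deg₂, Finsupp.single_apply, h, not_lt.mp h]

theorem mulX_mon (v : Fin n ⊕ Fin n) (d : (Fin n ⊕ Fin n) →₀ ℕ) :
    mulX F v (mon F d) = mon F (Finsupp.single v 1 + d) := by
  have h : (X v * monomial d 1 : MvPolynomial (Fin n ⊕ Fin n) F)
      = monomial (Finsupp.single v 1 + d) 1 := by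
    rw [X, monomial_mul, one_mul]
  exact h

theorem del_mon (v : Fin n ⊕ Fin n) (d : (Fin n ⊕ Fin n) →₀ ℕ) :
    del F v (mon F d) = (d v : F) • mon F (d - Finsupp.single v 1) := by
  have h : (pderiv v (monomial d 1) : MvPolynomial (Fin n ⊕ Fin n) F)
      = (d v : F) • monomial (d - Finsupp.single v 1) 1 := by
    rw [pderiv_monomial, smul_monomial, one_mul, smul_eq_mul, mul_one]
  exact h

theorem mulX_mem (v : Fin n ⊕ Fin n) {l₁ l₂ m₁ m₂ : ℤ} {f : Poly F n}
    (hf : f ∈ bigraded F n n₁ n₂ l₁ l₂) (h₁ : m₁ = deg₁ n₁ (Finsupp.single v 1) + l₁)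
    (h₂ : m₂ = deg₂ n₂ (Finsupp.single v 1) + l₂) :
    mulX F v f ∈ bigraded F n n₁ n₂ m₁ m₂ := by
  refine Submodule.span_induction (p := fun f _ => mulX F v f ∈ bigraded F n n₁ n₂ m₁ m₂)
    ?_ ?_ ?_ ?_ hf
  · rintro _ ⟨d, hd₁, hd₂, rfl⟩
    refine Submodule.subset_span ⟨Finsupp.single v 1 + d, ?_, ?_, mulX_mon F v d⟩
    · rw [deg₁_add, hd₁, h₁]
    · rw [deg₂_add, hd₂, h₂]
  · rw [map_zero]
    exact Submodule.zero_mem _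
  · intro a b _ _ ha hb
    rw [map_add]
    exact Submodule.add_mem _ ha hb
  · intro c a _ ha
    rw [map_smul]
    exact Submodule.smul_mem _ c ha

theorem del_mem (v : Fin n ⊕ Fin n) {l₁ l₂ m₁ m₂ : ℤ} {f : Poly F n}
    (hf : f ∈ bigraded F n n₁ n₂ l₁ l₂) (h₁ : l₁ = deg₁ n₁ (Finsupp.single v 1) + m₁)
    (h₂ : l₂ = deg₂ n₂ (Finsupp.single v 1) + m₂) :
    del F v f ∈ bigraded F n n₁ n₂ m₁ m₂ := by
  refine Submodule.span_induction (p := fun f _ => del F v f ∈ bigraded F n n₁ n₂ m₁ m₂)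
    ?_ ?_ ?_ ?_ hf
  · rintro _ ⟨d, hd₁, hd₂, rfl⟩
    rw [del_mon]
    by_cases hv : d v = 0
    · rw [hv, Nat.cast_zero, zero_smul]
      exact Submodule.zero_mem _
    · have hd : Finsupp.single v 1 + (d - Finsupp.single v 1) = d :=
        add_tsub_cancel_of_le (Finsupp.single_le_iff.mpr (Nat.one_le_iff_ne_zero.mpr hv))
      refine Submodule.smul_mem _ _ (Submodule.subset_span ⟨_, ?_, ?_, rfl⟩)
      · have := deg₁_add n₁ (Finsupp.single v 1) (d - Finsupp.single v 1)
        rw [hd] at this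
        omega
      · have := deg₂_add n₂ (Finsupp.single v 1) (d - Finsupp.single v 1)
        rw [hd] at this
        omega
  · rw [map_zero]
    exact Submodule.zero_mem _
  · intro a b _ _ ha hb
    rw [map_add]
    exact Submodule.add_mem _ ha hb
  · intro c a _ ha
    rw [map_smul]
    exact Submodule.smul_mem _ c ha

theorem Q_inl_mem (i : Fin n) {l₁ l₂ m₁ : ℤ} {f : Poly F n}
    (hf : f ∈ bigraded F n n₁ n₂ l₁ l₂) (hm : m₁ = l₁ + 1) :
    Q F n₁ n₂ (Sum.inl i) f ∈ bigraded F n n₁ n₂ m₁ l₂ := by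
  unfold Q swapped
  dsimp only
  split_ifs with h
  · refine del_mem F n₁ n₂ _ hf ?_ ?_ <;> simp [deg₁_single, deg₂_single, h, hm]
  · refine mulX_mem F n₁ n₂ _ hf ?_ ?_ <;> simp [deg₁_single, deg₂_single, h, hm, add_comm]

theorem P_inl_mem (i : Fin n) {l₁ l₂ m₁ : ℤ} {f : Poly F n}
    (hf : f ∈ bigraded F n n₁ n₂ l₁ l₂) (hm : l₁ = m₁ + 1) :
    P F n₁ n₂ (Sum.inl i) f ∈ bigraded F n n₁ n₂ m₁ l₂ := by
  unfold P swapped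
  dsimp only
  split_ifs with h
  · refine Submodule.neg_mem _ (mulX_mem F n₁ n₂ _ hf ?_ ?_) <;>
      simp [deg₁_single, deg₂_single, h, hm]
  · refine del_mem F n₁ n₂ _ hf ?_ ?_ <;> simp [deg₁_single, deg₂_single, h, hm, add_comm]

theorem Q_inr_mem (i : Fin n) {l₁ l₂ m₂ : ℤ} {f : Poly F n}
    (hf : f ∈ bigraded F n n₁ n₂ l₁ l₂) (hm : m₂ = l₂ + 1) :
    Q F n₁ n₂ (Sum.inr i) f ∈ bigraded F n n₁ n₂ l₁ m₂ := by
  unfold Q swapped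
  dsimp only
  by_cases h : (i : ℕ) < n₂
  · rw [if_neg (not_not.mpr h)]
    refine mulX_mem F n₁ n₂ _ hf ?_ ?_ <;> simp [deg₁_single, deg₂_single, h, hm, add_comm]
  · rw [if_pos h]
    refine del_mem F n₁ n₂ _ hf ?_ ?_ <;> simp [deg₁_single, deg₂_single, h, hm]

theorem P_inr_mem (i : Fin n) {l₁ l₂ m₂ : ℤ} {f : Poly F n}
    (hf : f ∈ bigraded F n n₁ n₂ l₁ l₂) (hm : l₂ = m₂ + 1) :
    P F n₁ n₂ (Sum.inr i) f ∈ bigraded F n n₁ n₂ l₁ m₂ := by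
  unfold P swapped
  dsimp only
  by_cases h : (i : ℕ) < n₂
  · rw [if_neg (not_not.mpr h)]
    refine del_mem F n₁ n₂ _ hf ?_ ?_ <;> simp [deg₁_single, deg₂_single, h, hm, add_comm]
  · rw [if_pos h]
    refine Submodule.neg_mem _ (mulX_mem F n₁ n₂ _ hf ?_ ?_) <;>
      simp [deg₁_single, deg₂_single, h, hm]

theorem E_mem (i j : Fin n) {l₁ l₂ : ℤ} {f : Poly F n}
    (hf : f ∈ bigraded F n n₁ n₂ l₁ l₂) : E F n₁ n₂ i j f ∈ bigraded F n n₁ n₂ l₁ l₂ := by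
  rw [E_eq]
  refine Submodule.sub_mem _ ?_ ?_
  · exact Q_inl_mem F n₁ n₂ i (P_inl_mem F n₁ n₂ j (m₁ := l₁ - 1) hf (by ring)) (by ring)
  · exact Q_inr_mem F n₁ n₂ j (P_inr_mem F n₁ n₂ i (m₂ := l₂ - 1) hf (by ring)) (by ring)

/-! ### The `sl(n, F)`-modules -/

attribute [local instance 100] LieRing.ofAssociativeRing

/-- The linear extension `A ↦ ∑ A_{i,j} E_{i,j}` of the action to all matrices. -/
def action : Matrix (Fin n) (Fin n) F →ₗ[F] Module.End F (Poly F n) where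
  toFun A := ∑ i, ∑ j, A i j • E F n₁ n₂ i j
  map_add' A B := by simp only [Matrix.add_apply, add_smul, Finset.sum_add_distrib]
  map_smul' c A := by
    simp only [Matrix.smul_apply, smul_eq_mul, mul_smul, Finset.smul_sum, RingHom.id_apply]

theorem action_mul (A B : Matrix (Fin n) (Fin n) F) :
    action F n₁ n₂ (A * B - B * A)
      = action F n₁ n₂ A * action F n₁ n₂ B - action F n₁ n₂ B * action F n₁ n₂ A := by
  have swap : ∀ f : Fin n → Fin n → Fin n → Fin n → Module.End F (Poly F n),
      ∑ k, ∑ l, ∑ i, ∑ j, f i j k l = ∑ i, ∑ j, ∑ k, ∑ l, f i j k l := by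
    intro f
    rw [Finset.sum_congr rfl fun k _ => Finset.sum_comm, Finset.sum_comm]
    refine Finset.sum_congr rfl fun i _ => ?_
    rw [Finset.sum_congr rfl fun k _ => Finset.sum_comm, Finset.sum_comm]
  have h : action F n₁ n₂ A * action F n₁ n₂ B - action F n₁ n₂ B * action F n₁ n₂ A
      = ∑ i, ∑ j, ∑ k, ∑ l, (A i j * B k l) •
        (E F n₁ n₂ i j * E F n₁ n₂ k l - E F n₁ n₂ k l * E F n₁ n₂ i j) := by
    have h1 : action F n₁ n₂ A * action F n₁ n₂ B
        = ∑ i, ∑ j, ∑ k, ∑ l, (A i j * B k l) • (E F n₁ n₂ i j * E F n₁ n₂ k l) := by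
      change (∑ i, ∑ j, A i j • E F n₁ n₂ i j) * (∑ k, ∑ l, B k l • E F n₁ n₂ k l) = _
      rw [← swap]
      simp only [Finset.sum_mul, Finset.mul_sum, smul_mul_smul_comm]
    have h2 : action F n₁ n₂ B * action F n₁ n₂ A
        = ∑ i, ∑ j, ∑ k, ∑ l, (A i j * B k l) • (E F n₁ n₂ k l * E F n₁ n₂ i j) := by
      change (∑ k, ∑ l, B k l • E F n₁ n₂ k l) * (∑ i, ∑ j, A i j • E F n₁ n₂ i j) = _
      simp only [Finset.sum_mul, Finset.mul_sum, smul_mul_smul_comm, mul_comm (B _ _)]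
    rw [h1, h2]
    simp only [← Finset.sum_sub_distrib, smul_sub]
  have hAB : ∀ A B : Matrix (Fin n) (Fin n) F, action F n₁ n₂ (A * B)
      = ∑ i, ∑ j, ∑ k, ∑ l, (A i j * B k l) • (if j = k then E F n₁ n₂ i l else 0) := by
    intro A B
    change (∑ i, ∑ l, (A * B) i l • E F n₁ n₂ i l) = _
    refine Finset.sum_congr rfl fun i _ => ?_
    simp only [Matrix.mul_apply, Finset.sum_smul, smul_ite, smul_zero]
    rw [Finset.sum_comm]
    refine Finset.sum_congr rfl fun j _ => ?_
    rw [Finset.sum_comm]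
    refine Finset.sum_congr rfl fun l _ => ?_
    simp
  have hBA : action F n₁ n₂ (B * A)
      = ∑ i, ∑ j, ∑ k, ∑ l, (A i j * B k l) • (if l = i then E F n₁ n₂ k j else 0) := by
    rw [hAB, ← swap]
    simp only [mul_comm (B _ _)]
  rw [map_sub, hAB, hBA, h]
  simp only [E_comm, smul_sub, Finset.sum_sub_distrib]

variable (n)

/-- The Lie algebra `sl(n, F)`. -/
abbrev sl := LieAlgebra.SpecialLinear.sl (Fin n) F

/-- The oscillator representation of `sl(n, F)`. -/
def oscRep : sl F n →ₗ⁅F⁆ Module.End F (Poly F n) where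
  toLinearMap := (action F n₁ n₂).comp (sl F n).toSubmodule.subtype
  map_lie' {A B} := action_mul F n₁ n₂ A.1 B.1

theorem oscRep_mem (h : n₁ ≤ n₂) (l₁ l₂ : ℤ) (A : sl F n) {f : Poly F n}
    (hf : f ∈ bigraded F n n₁ n₂ l₁ l₂ ⊓ LinearMap.ker (laplace F n n₁ n₂)) :
    oscRep F n n₁ n₂ A f ∈ bigraded F n n₁ n₂ l₁ l₂ ⊓ LinearMap.ker (laplace F n n₁ n₂) := by
  have e : oscRep F n n₁ n₂ A f = ∑ i, ∑ j, A.1 i j • E F n₁ n₂ i j f := by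
    change (∑ i, ∑ j, A.1 i j • E F n₁ n₂ i j) f = _
    simp only [LinearMap.sum_apply, LinearMap.smul_apply]
  rw [e]
  refine Submodule.sum_mem _ fun i _ => Submodule.sum_mem _ fun j _ =>
    Submodule.smul_mem _ _ ⟨E_mem F n₁ n₂ i j hf.1, ?_⟩
  have h2 := congrArg (fun T : Module.End F (Poly F n) => T f) (E_laplace F n₁ n₂ h i j)
  have h3 : laplace F n n₁ n₂ f = 0 := hf.2
  simp only [Module.End.mul_apply, h3, map_zero] at h2
  exact h2

/-- The polynomial algebra as an `sl(n, F)`-module through the representation `oscRep`. -/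
def OscModule (_n₁ _n₂ : ℕ) : Type _ := Poly F n

instance : AddCommGroup (OscModule F n n₁ n₂) := inferInstanceAs (AddCommGroup (Poly F n))
instance : Module F (OscModule F n n₁ n₂) := inferInstanceAs (Module F (Poly F n))
instance : LieRingModule (sl F n) (OscModule F n n₁ n₂) :=
  LieRingModule.compLieHom (Poly F n) (oscRep F n n₁ n₂)
instance : LieModule F (sl F n) (OscModule F n n₁ n₂) :=
  LieModule.compLieHom (Poly F n) (oscRep F n n₁ n₂)

/-- The `sl(n, F)`-module `H_{⟨ℓ₁,ℓ₂⟩}` of the `f ∈ B_{⟨ℓ₁,ℓ₂⟩}` with `laplace f = 0`. -/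
def harmonic (h : n₁ ≤ n₂) (l₁ l₂ : ℤ) : LieSubmodule F (sl F n) (OscModule F n n₁ n₂) where
  toSubmodule := bigraded F n n₁ n₂ l₁ l₂ ⊓ LinearMap.ker (laplace F n n₁ n₂)
  lie_mem := fun {A _} hf => oscRep_mem F n n₁ n₂ h l₁ l₂ A hf

end Osc

/-- The action of the universal enveloping algebra on a module of a Lie algebra. -/
def envelopingAction (F L M : Type*) [Field F] [LieRing L] [LieAlgebra F L] [AddCommGroup M]
    [Module F M] [LieRingModule L M] [LieModule F L M] :
    UniversalEnvelopingAlgebra F L →ₐ[F] Module.End F M :=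
  UniversalEnvelopingAlgebra.lift F (LieModule.toEnd F L M)

end Oscillator

end

/-!
The value `n - 1` is detected by comparing two elementary bounds for the growth of `V^k M₀`.

*Growth of a filtered module.* Generating subspaces `V` and `M₀` enter only through two facts. If
the module has an exhaustive filtration whose `t`-th piece has dimension `O(t^N)`, and every element
of the algebra shifts it by a bounded amount, then the Gelfand–Kirillov dimension is at most `N`
(`gkDim_le_of_filtration`). If `N` elements of the algebra have ordered monomials that send some
vector of `M₀` to linearly independent vectors, it is at least `N` (`le_gkDim`).

*Lower bounds.* For `j ≤ n₁ < i` the operator `E_{i,j}` is multiplication by `-x_i x_j`, plus either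
`y_i y_j` or a term with a derivative. For a suitable weighting of the variables it acts in top
weight as multiplication by the monomial `x_i x_j` or by `y_i y_j`. Operators whose symbols are
monomials with linearly independent exponents have linearly independent ordered monomials on every
nonzero polynomial (`linearIndependent_orderedMonomial`), because the polynomial ring is a domain.
When `n₁ < n`, the edges of a spanning tree of the complete bipartite graph between `{1, …, n₁}` and
`{n₁ + 1, …, n}` give `n - 1` such operators, with symbols `x_i x_j` (`pred_le_gkDim_harmonic`). When
`n₁ < n₂ < n`, or `n₁ = n₂` lies strictly between `1` and `n - 1`, one more operator with a symbol
`y_b y_d` is available, and the dimension is at least `n` (`le_gkDim_harmonic_of_extra`).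

*Upper bounds.* If `n₂ = n`, the second degree bounds the exponents of all `y_i`, and the first
degree leaves `n - 1` free exponents among the `x_i`. If `n₁ = n₂ = 1`, the deformed Laplace operator
is a vector field containing `x₁ ∂_{y₁}` and neither `y₁` nor `∂_{y₁}` otherwise. Hence a harmonic
polynomial is determined by its restriction to `y₁ = 0` (`eq_zero_of_vectorField`), where the second
degree bounds the exponents of all `y_i`. The case `n₁ = n₂ = n - 1` is symmetric, with `x_n` in place
of `y₁`. Finally, `n₁ = n₂ = n` makes the module finite-dimensional, so that its dimension `0` differs
from `n - 1`. An irreducible module is nonzero, as the lower bounds require.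
-/

noncomputable section

namespace Oscillator

/-! ### Growth and Gelfand–Kirillov dimension -/

section GKBounds

variable {F A M : Type*} [Field F] [Ring A] [Algebra F A] [AddCommGroup M] [Module F M]

theorem pow_le_productsUpTo (V : Submodule F A) {j k : ℕ} (h : j ≤ k) :
    V ^ j ≤ productsUpTo V k :=
  le_iSup (fun j : Fin (k + 1) => V ^ (j : ℕ)) ⟨j, Nat.lt_succ_of_le h⟩

theorem productsUpTo_mono (V : Submodule F A) {j k : ℕ} (h : j ≤ k) :
    productsUpTo V j ≤ productsUpTo V k :=
  iSup_le fun i => pow_le_productsUpTo V ((Nat.lt_succ_iff.mp i.2).trans h)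

theorem mul_mem_productsUpTo (V : Submodule F A) {a b : ℕ} {u v : A}
    (hu : u ∈ productsUpTo V a) (hv : v ∈ productsUpTo V b) :
    u * v ∈ productsUpTo V (a + b) := by
  have h : productsUpTo V a * productsUpTo V b ≤ productsUpTo V (a + b) := by
    unfold productsUpTo
    rw [Submodule.iSup_mul]
    refine iSup_le fun i => ?_
    rw [Submodule.mul_iSup]
    refine iSup_le fun j => ?_
    rw [← pow_add]
    exact pow_le_productsUpTo V (by omega)
  exact h (Submodule.mul_mem_mul hu hv)

theorem one_mem_productsUpTo (V : Submodule F A) (k : ℕ) : (1 : A) ∈ productsUpTo V k :=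
  pow_le_productsUpTo V (Nat.zero_le k) (by rw [pow_zero]; exact Submodule.one_le.mp le_rfl)

theorem pow_mem_productsUpTo (V : Submodule F A) {a : ℕ} {u : A} (hu : u ∈ productsUpTo V a)
    (k : ℕ) : u ^ k ∈ productsUpTo V (a * k) := by
  induction k with
  | zero => rw [pow_zero]; exact one_mem_productsUpTo V _
  | succ k ih => rw [pow_succ]; exact mul_mem_productsUpTo V ih hu

theorem exists_mem_productsUpTo {V : Submodule F A} (hV : Algebra.adjoin F (V : Set A) = ⊤)
    (u : A) : ∃ k, u ∈ productsUpTo V k := by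
  have hu : u ∈ Algebra.adjoin F (V : Set A) := hV ▸ Algebra.mem_top
  induction hu using Algebra.adjoin_induction with
  | mem v hv => exact ⟨1, pow_le_productsUpTo V le_rfl (by rw [pow_one]; exact hv)⟩
  | algebraMap r =>
    refine ⟨0, ?_⟩
    rw [Algebra.algebraMap_eq_smul_one]
    exact Submodule.smul_mem _ _ (one_mem_productsUpTo V 0)
  | add a b _ _ ha hb =>
    obtain ⟨k, hk⟩ := ha
    obtain ⟨l, hl⟩ := hb
    exact ⟨max k l, Submodule.add_mem _ (productsUpTo_mono V (le_max_left k l) hk)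
      (productsUpTo_mono V (le_max_right k l) hl)⟩
  | mul a b _ _ ha hb =>
    obtain ⟨k, hk⟩ := ha
    obtain ⟨l, hl⟩ := hb
    exact ⟨k + l, mul_mem_productsUpTo V hk hl⟩

theorem finiteDimensional_actOn (φ : A →ₐ[F] Module.End F M) (V : Submodule F A)
    (M₀ : Submodule F M) [FiniteDimensional F V] [FiniteDimensional F M₀] (k : ℕ) :
    FiniteDimensional F (actOn φ (productsUpTo V k) M₀) := by
  have hV : V.FG := Module.Finite.iff_fg.mp inferInstance
  have h1 : (productsUpTo V k).FG := Submodule.fg_iSup _ fun j => hV.pow j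
  exact Module.Finite.iff_fg.mpr (h1.map₂ _ (Module.Finite.iff_fg.mp inferInstance))

/-- The product `T₀^γ₀ T₁^γ₁ ⋯` of powers of (not necessarily commuting) elements, taken in the
order of the indices. -/
def orderedMonomial {R : Type*} [Monoid R] {N : ℕ} (T : Fin N → R) (γ : Fin N → ℕ) : R :=
  (List.ofFn fun s => T s ^ γ s).prod

theorem orderedMonomial_succ {R : Type*} [Monoid R] {N : ℕ} (T : Fin (N + 1) → R)
    (γ : Fin (N + 1) → ℕ) : orderedMonomial T γ =
      T 0 ^ γ 0 * orderedMonomial (fun s => T s.succ) (fun s => γ s.succ) := by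
  simp [orderedMonomial, List.ofFn_succ]

theorem map_orderedMonomial {R S : Type*} [Monoid R] [Monoid S] (φ : R →* S) {N : ℕ}
    (T : Fin N → R) (γ : Fin N → ℕ) :
    φ (orderedMonomial T γ) = orderedMonomial (fun s => φ (T s)) γ := by
  simp only [orderedMonomial, map_list_prod, List.map_ofFn]
  congr 2
  funext s
  simp

theorem orderedMonomial_mem_productsUpTo (V : Submodule F A) {c k N : ℕ} {T : Fin N → A}
    (hT : ∀ s, T s ∈ productsUpTo V c) {γ : Fin N → ℕ} (hγ : ∀ s, γ s ≤ k) :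
    orderedMonomial T γ ∈ productsUpTo V (c * k * N) := by
  induction N with
  | zero => simpa [orderedMonomial] using one_mem_productsUpTo V _
  | succ N ih =>
    rw [orderedMonomial_succ]
    refine productsUpTo_mono V (le_of_eq (by ring : c * k + c * k * N = _))
      (mul_mem_productsUpTo V ?_ (ih (fun s => hT s.succ) fun s => hγ s.succ))
    exact productsUpTo_mono V (Nat.mul_le_mul_left c (hγ 0)) (pow_mem_productsUpTo V (hT 0) _)

open Filter Topology in
theorem tendsto_log_mul_pow_div_log (c : ℝ) (hc : 0 < c) (N : ℕ) :
    Tendsto (fun k : ℕ => Real.log (c * ((k : ℝ) + 1) ^ N) / Real.log k) atTop (𝓝 N) := by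
  have hlog : Tendsto (fun k : ℕ => Real.log (k : ℝ)) atTop atTop :=
    Real.tendsto_log_atTop.comp tendsto_natCast_atTop_atTop
  have h1 : Tendsto (fun k : ℕ => Real.log ((k : ℝ) + 1) / Real.log k) atTop (𝓝 1) := by
    have h2 : Tendsto (fun k : ℕ => 1 + Real.log 2 / Real.log k) atTop (𝓝 (1 + 0)) :=
      tendsto_const_nhds.add (hlog.const_div_atTop _)
    rw [add_zero] at h2
    refine tendsto_of_tendsto_of_tendsto_of_le_of_le' tendsto_const_nhds h2 ?_ ?_
    · filter_upwards [eventually_ge_atTop 2] with k hk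
      have hk' : (2 : ℝ) ≤ k := by exact_mod_cast hk
      rw [le_div_iff₀ (Real.log_pos (by linarith)), one_mul]
      exact Real.log_le_log (by linarith) (by linarith)
    · filter_upwards [eventually_ge_atTop 2] with k hk
      have hk' : (2 : ℝ) ≤ k := by exact_mod_cast hk
      have hpos := Real.log_pos (by linarith : (1 : ℝ) < k)
      rw [div_le_iff₀ hpos, add_mul, one_mul, div_mul_cancel₀ _ hpos.ne',
        ← Real.log_mul (by linarith) two_ne_zero]
      exact Real.log_le_log (by linarith) (by linarith)
  have h3 := (hlog.const_div_atTop (Real.log c)).add (h1.const_mul (N : ℝ))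
  rw [zero_add, mul_one] at h3
  refine h3.congr fun k => ?_
  have hk : (0 : ℝ) < (k : ℝ) + 1 := by positivity
  rw [Real.log_mul hc.ne' (pow_pos hk N).ne', Real.log_pow, add_div, mul_div_assoc]

open Filter Topology in
/-- Polynomial growth of degree `N` of the filtration bounds the Gelfand–Kirillov dimension. -/
theorem gkDim_le (φ : A →ₐ[F] Module.End F M) (V : Submodule F A) (M₀ : Submodule F M)
    (N c : ℕ)
    (h : ∀ k, Module.finrank F (actOn φ (productsUpTo V k) M₀) ≤ c * (k + 1) ^ N) :
    gkDim φ V M₀ ≤ ((N : ℝ) : EReal) := by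
  have ht : Tendsto (fun k : ℕ =>
      ((Real.log (((c : ℝ) + 1) * ((k : ℝ) + 1) ^ N) / Real.log k : ℝ) : EReal)) atTop
      (𝓝 ((N : ℝ) : EReal)) :=
    (continuous_coe_real_ereal.tendsto _).comp
      (tendsto_log_mul_pow_div_log ((c : ℝ) + 1) (by positivity) N)
  rw [← ht.limsup_eq]
  refine limsup_le_limsup (Eventually.of_forall fun k => ?_)
  refine EReal.coe_le_coe_iff.mpr (div_le_div_of_nonneg_right ?_ (Real.log_natCast_nonneg k))
  rcases Nat.eq_zero_or_pos (Module.finrank F (actOn φ (productsUpTo V k) M₀)) with h0 | h0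
  · rw [h0, Nat.cast_zero, Real.log_zero]
    refine Real.log_nonneg ?_
    have h1 : (1 : ℝ) ≤ ((k : ℝ) + 1) ^ N :=
      one_le_pow₀ (by linarith [(Nat.cast_nonneg k : (0 : ℝ) ≤ k)])
    nlinarith [(Nat.cast_nonneg c : (0 : ℝ) ≤ c)]
  · refine Real.log_le_log (by exact_mod_cast h0) ?_
    have h1 : (Module.finrank F (actOn φ (productsUpTo V k) M₀) : ℝ) ≤ c * ((k : ℝ) + 1) ^ N := by
      exact_mod_cast h k
    have h2 : (0 : ℝ) ≤ ((k : ℝ) + 1) ^ N := by positivity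
    linarith

open Filter Topology in
theorem tendsto_log_pow_div_log_mul (N : ℕ) {C : ℕ} (hC : 0 < C) :
    Tendsto (fun k : ℕ => Real.log (((k : ℝ) + 1) ^ N) / Real.log (C * k : ℕ)) atTop (𝓝 N) := by
  have h1 := tendsto_log_mul_pow_div_log 1 one_pos N
  have h2 : Tendsto (fun k : ℕ => Real.log k / Real.log (C * k : ℕ)) atTop (𝓝 1) := by
    have hlog : Tendsto (fun k : ℕ => Real.log (k : ℝ)) atTop atTop :=
      Real.tendsto_log_atTop.comp tendsto_natCast_atTop_atTop
    have h3 : Tendsto (fun k : ℕ => (1 + Real.log C / Real.log k)⁻¹) atTop (𝓝 (1 + 0)⁻¹) :=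
      (tendsto_const_nhds.add (hlog.const_div_atTop _)).inv₀ (by norm_num)
    rw [add_zero, inv_one] at h3
    refine h3.congr' ?_
    filter_upwards [eventually_ge_atTop 2] with k hk
    have hk' : (2 : ℝ) ≤ k := by exact_mod_cast hk
    have hpos := Real.log_pos (by linarith : (1 : ℝ) < k)
    have hC0 : (C : ℝ) ≠ 0 := by positivity
    rw [Nat.cast_mul, Real.log_mul hC0 (by linarith)]
    field_simp
    ring
  have h4 := h1.mul h2
  rw [mul_one] at h4
  refine h4.congr' ?_
  filter_upwards [eventually_ge_atTop 2] with k hk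
  have hk' : (2 : ℝ) ≤ k := by exact_mod_cast hk
  have hpos := Real.log_pos (by linarith : (1 : ℝ) < k)
  rw [one_mul, div_mul_div_cancel₀ hpos.ne']

open Filter in
theorem limsup_comp_le (u : ℕ → EReal) {e : ℕ → ℕ} (he : Tendsto e atTop atTop) :
    limsup (fun k => u (e k)) atTop ≤ limsup u atTop := by
  have h : limsup (u ∘ e) atTop = limsup u (map e atTop) := rfl
  exact h.le.trans (limsup_le_limsup_of_le he)

open Filter Topology in
theorem le_gkDim_of_le_finrank (φ : A →ₐ[F] Module.End F M) (V : Submodule F A)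
    (M₀ : Submodule F M) (N : ℕ) {C : ℕ} (hC : 0 < C)
    (hdim : ∀ k, (k + 1) ^ N ≤ Module.finrank F (actOn φ (productsUpTo V (C * k)) M₀)) :
    ((N : ℝ) : EReal) ≤ gkDim φ V M₀ := by
  have hsub : Tendsto (fun k : ℕ => C * k) atTop atTop :=
    tendsto_id.const_mul_atTop' hC
  have ht : Tendsto (fun k : ℕ => ((Real.log (((k : ℝ) + 1) ^ N) / Real.log (C * k : ℕ) : ℝ) :
      EReal)) atTop (𝓝 ((N : ℝ) : EReal)) :=
    (continuous_coe_real_ereal.tendsto _).comp (tendsto_log_pow_div_log_mul N hC)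
  rw [← ht.limsup_eq]
  refine le_trans (limsup_le_limsup (Eventually.of_forall fun k => ?_)) (limsup_comp_le
    (fun j : ℕ => ((Real.log (Module.finrank F (actOn φ (productsUpTo V j) M₀)) / Real.log j : ℝ) :
      EReal)) hsub)
  have hk : (((k : ℝ) + 1) ^ N) ≤ Module.finrank F (actOn φ (productsUpTo V (C * k)) M₀) := by
    exact_mod_cast hdim k
  exact EReal.coe_le_coe_iff.mpr (div_le_div_of_nonneg_right
    (Real.log_le_log (by positivity) hk) (Real.log_natCast_nonneg _))

/-- If the ordered monomials in `N` elements of the algebra send some vector of `M₀` to linearly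
independent vectors, then the Gelfand–Kirillov dimension is at least `N`. -/
theorem le_gkDim (φ : A →ₐ[F] Module.End F M) (V : Submodule F A) (hV : IsGeneratingSpace V)
    (M₀ : Submodule F M) [FiniteDimensional F M₀] (N : ℕ) (T : Fin N → A) (m : M) (hm : m ∈ M₀)
    (hli : LinearIndependent F fun γ : Fin N → ℕ => φ (orderedMonomial T γ) m) :
    ((N : ℝ) : EReal) ≤ gkDim φ V M₀ := by
  have := hV.1
  choose e he using fun s => exists_mem_productsUpTo hV.2 (T s)
  let c := Finset.univ.sup e
  have hT : ∀ s, T s ∈ productsUpTo V c := fun s =>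
    productsUpTo_mono V (Finset.le_sup (Finset.mem_univ s)) (he s)
  refine le_gkDim_of_le_finrank φ V M₀ N (C := c * N + 1) (Nat.succ_pos _) fun k => ?_
  have := finiteDimensional_actOn φ V M₀ ((c * N + 1) * k)
  let v : (Fin N → Fin (k + 1)) → actOn φ (productsUpTo V ((c * N + 1) * k)) M₀ := fun γ =>
    ⟨φ (orderedMonomial T fun s => (γ s : ℕ)) m, by
      refine Submodule.apply_mem_map₂ φ.toLinearMap ?_ hm
      refine productsUpTo_mono V ?_
        (orderedMonomial_mem_productsUpTo V (k := k) hT fun s => Nat.lt_succ_iff.mp (γ s).2)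
      nlinarith⟩
  have hv : LinearIndependent F v := by
    refine LinearIndependent.of_comp (Submodule.subtype _) ?_
    refine hli.comp (fun γ : Fin N → Fin (k + 1) => fun s => (γ s : ℕ)) ?_
    intro γ δ h
    funext s
    exact Fin.ext (congrFun h s)
  have := hv.fintype_card_le_finrank
  simpa using this

/-- Operators that shift a filtration by a bounded amount form a subalgebra. -/
def boundedShift (G : ℕ → Submodule F M) (hG : Monotone G) : Subalgebra F (Module.End F M) where
  carrier := {T | ∃ c, ∀ t, ∀ f ∈ G t, T f ∈ G (t + c)}
  mul_mem' := by
    rintro S T ⟨a, ha⟩ ⟨b, hb⟩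
    refine ⟨b + a, fun t f hf => ?_⟩
    rw [← add_assoc]
    exact ha _ _ (hb _ _ hf)
  add_mem' := by
    rintro S T ⟨a, ha⟩ ⟨b, hb⟩
    refine ⟨a + b, fun t f hf => Submodule.add_mem _ (hG ?_ (ha _ _ hf)) (hG ?_ (hb _ _ hf))⟩ <;>
      omega
  algebraMap_mem' r := ⟨0, fun t f hf => Submodule.smul_mem _ r hf⟩

theorem actOn_productsUpTo_le (φ : A →ₐ[F] Module.End F M) {V : Submodule F A}
    {M₀ : Submodule F M} {G : ℕ → Submodule F M} (hG : Monotone G) {c t₀ : ℕ}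
    (hV : ∀ v ∈ V, ∀ t, ∀ f ∈ G t, φ v f ∈ G (t + c)) (hM₀ : M₀ ≤ G t₀) (k : ℕ) :
    actOn φ (productsUpTo V k) M₀ ≤ G (t₀ + c * k) := by
  have hpow : ∀ j, ∀ u ∈ V ^ j, ∀ t, ∀ f ∈ G t, φ u f ∈ G (t + c * j) := by
    intro j
    induction j with
    | zero =>
      intro u hu t f hf
      rw [pow_zero] at hu
      obtain ⟨r, rfl⟩ := Submodule.mem_one.mp hu
      rw [AlgHom.commutes]
      exact Submodule.smul_mem _ r hf
    | succ j ih =>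
      intro u hu t f hf
      rw [pow_succ] at hu
      refine Submodule.mul_induction_on hu ?_ ?_
      · intro a ha b hb
        rw [map_mul, show t + c * (j + 1) = (t + c) + c * j by ring]
        exact ih a ha _ _ (hV b hb _ _ hf)
      · intro a b ha hb
        rw [map_add]
        exact Submodule.add_mem _ ha hb
  unfold actOn
  rw [Submodule.map₂_le]
  intro u hu f hf
  have hle : productsUpTo V k ≤ (G (t₀ + c * k)).comap (φ.toLinearMap.flip f) := by
    refine iSup_le fun j a ha => ?_
    exact hG (Nat.add_le_add_left (Nat.mul_le_mul_left c (Nat.lt_succ_iff.mp j.2)) _)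
      (hpow j a ha _ _ (hM₀ hf))
  exact hle hu

theorem exists_le_of_finiteDimensional {W : Submodule F M} [FiniteDimensional F W]
    {G : ℕ → Submodule F M} (hG : Monotone G) (h : ∀ f ∈ W, ∃ t, f ∈ G t) : ∃ t, W ≤ G t := by
  obtain ⟨s, hs⟩ := (Module.Finite.iff_fg.mp inferInstance : W.FG)
  have h' : ∀ f : s, ∃ t, (f : M) ∈ G t := fun f => h _ (hs ▸ Submodule.subset_span f.2)
  choose t ht using h'
  refine ⟨Finset.univ.sup t, ?_⟩
  rw [← hs, Submodule.span_le]
  exact fun f hf => hG (Finset.le_sup (Finset.mem_univ ⟨f, hf⟩)) (ht ⟨f, hf⟩)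

/-- An upper bound for the Gelfand–Kirillov dimension from an exhaustive filtration of the module
whose pieces grow polynomially and which every element of the algebra shifts by a bounded
amount. -/
theorem gkDim_le_of_filtration (φ : A →ₐ[F] Module.End F M) (V : Submodule F A)
    [FiniteDimensional F V] (M₀ : Submodule F M) [FiniteDimensional F M₀]
    (G : ℕ → Submodule F M) (hG : Monotone G) (hex : ∀ f, ∃ t, f ∈ G t)
    (hφ : ∀ a, φ a ∈ boundedShift G hG) (N C : ℕ)
    (hdim : ∀ t, ∀ K : Submodule F M, K ≤ G t → Module.finrank F K ≤ C * (t + 1) ^ N) :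
    gkDim φ V M₀ ≤ ((N : ℝ) : EReal) := by
  obtain ⟨t₀, ht₀⟩ := exists_le_of_finiteDimensional (W := M₀) hG fun f _ => hex f
  let S : ℕ → Submodule F A := fun c =>
    { carrier := {a | ∀ t, ∀ f ∈ G t, φ a f ∈ G (t + c)}
      add_mem' := fun {a b} ha hb t f hf => by
        rw [map_add]
        exact Submodule.add_mem _ (ha t f hf) (hb t f hf)
      zero_mem' := fun t f _ => by
        rw [map_zero]
        exact Submodule.zero_mem _
      smul_mem' := fun r a ha t f hf => by
        rw [map_smul]
        exact Submodule.smul_mem _ r (ha t f hf) }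
  have hS : Monotone S := fun c d hcd a ha t f hf => hG (Nat.add_le_add_left hcd t) (ha t f hf)
  obtain ⟨c, hc⟩ := exists_le_of_finiteDimensional (W := V) hS fun a _ => hφ a
  refine gkDim_le φ V M₀ N (C * (t₀ + c + 1) ^ N) fun k => ?_
  refine (hdim _ _ (actOn_productsUpTo_le φ hG (fun v hv => hc hv) ht₀ k)).trans ?_
  rw [mul_assoc, ← mul_pow]
  refine Nat.mul_le_mul_left C (Nat.pow_le_pow_left ?_ N)
  nlinarith [Nat.zero_le (t₀ * k), Nat.zero_le k, Nat.zero_le c]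

end GKBounds

/-! ### Operators with monomial symbols -/

section Weights

variable {F σ : Type*} [Field F]

/-- The polynomials all of whose monomials have weight less than `t`. The strict inequality makes
the zero polynomial the only one with `t = 0`. -/
def weightLT (F : Type*) {σ : Type*} [Field F] (w : σ → ℕ) (t : ℕ) :
    Submodule F (MvPolynomial σ F) :=
  restrictSupport F {d | Finsupp.weight w d < t}

theorem mem_weightLT {w : σ → ℕ} {t : ℕ} {f : MvPolynomial σ F} :
    f ∈ weightLT F w t ↔ ∀ d, coeff d f ≠ 0 → Finsupp.weight w d < t := by
  rw [weightLT, mem_restrictSupport_iff]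
  exact ⟨fun h d hd => h (mem_support_iff.mpr hd), fun h d hd => h d (mem_support_iff.mp hd)⟩

theorem weightLT_mono (w : σ → ℕ) : Monotone (weightLT F w) := fun _ _ h =>
  restrictSupport_mono F fun _ hd => lt_of_lt_of_le hd h

theorem exists_mem_weightLT (w : σ → ℕ) (f : MvPolynomial σ F) : ∃ t, f ∈ weightLT F w t := by
  refine ⟨f.support.sup (Finsupp.weight w) + 1, mem_weightLT.mpr fun d hd => ?_⟩
  exact Nat.lt_succ_of_le (Finset.le_sup (mem_support_iff.mpr hd))

theorem monomial_mem_weightLT {w : σ → ℕ} {d : σ →₀ ℕ} {t : ℕ} (c : F)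
    (h : Finsupp.weight w d < t) : monomial d c ∈ weightLT F w t := by
  rw [weightLT, monomial_mem_restrictSupport]
  exact Or.inl h

theorem mul_mem_weightLT {w : σ → ℕ} {s t : ℕ} {f g : MvPolynomial σ F}
    (hf : f ∈ weightLT F w (s + 1)) (hg : g ∈ weightLT F w t) :
    f * g ∈ weightLT F w (s + t) := by
  classical
  rw [mem_weightLT] at *
  intro d hd
  obtain ⟨a, ha, b, hb, rfl⟩ := Finset.mem_add.mp (support_mul f g (mem_support_iff.mpr hd))
  have h1 := hf a (mem_support_iff.mp ha)
  have h2 := hg b (mem_support_iff.mp hb)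
  rw [map_add]
  omega

theorem monomial_mul_mem_weightLT {w : σ → ℕ} {t s : ℕ} {f : MvPolynomial σ F} (m : σ →₀ ℕ)
    (c : F) (hf : f ∈ weightLT F w t) (hs : t + Finsupp.weight w m ≤ s) :
    monomial m c * f ∈ weightLT F w s :=
  weightLT_mono w (by omega)
    (mul_mem_weightLT (monomial_mem_weightLT c (Nat.lt_succ_self (Finsupp.weight w m))) hf)

theorem X_mul_mem_weightLT {w : σ → ℕ} {t s : ℕ} {f : MvPolynomial σ F} (v : σ)
    (hf : f ∈ weightLT F w t) (hs : t + w v ≤ s) : X v * f ∈ weightLT F w s := by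
  refine monomial_mul_mem_weightLT (Finsupp.single v 1) 1 hf ?_
  simpa [Finsupp.weight_single] using hs

theorem pderiv_mem_weightLT {w : σ → ℕ} {t : ℕ} {f : MvPolynomial σ F} (v : σ)
    (hf : f ∈ weightLT F w t) : pderiv v f ∈ weightLT F w t := by
  rw [mem_weightLT] at *
  intro d hd
  rw [coeff_pderiv] at hd
  have h := hf _ (left_ne_zero_of_mul hd)
  rw [map_add] at h
  omega

/-- The weight of a product of nonzero polynomials is the sum of the weights. -/
theorem mul_notMem_weightLT {w : σ → ℕ} {s t : ℕ} {f g : MvPolynomial σ F}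
    (hf : f ∈ weightLT F w (s + 1)) (hg : g ∈ weightLT F w (t + 1))
    (hf' : f ∉ weightLT F w s) (hg' : g ∉ weightLT F w t) : f * g ∉ weightLT F w (s + t) := by
  classical
  intro h
  have key : ∀ {r : ℕ} {p : MvPolynomial σ F}, p ∈ weightLT F w (r + 1) →
      p - weightedHomogeneousComponent w r p ∈ weightLT F w r := by
    intro r p hp
    rw [mem_weightLT] at *
    intro d hd
    rw [coeff_sub, coeff_weightedHomogeneousComponent] at hd
    split_ifs at hd with hr
    · simp at hd
    · have := hp d (by simpa using hd)
      omega
  have hcomp : ∀ {r : ℕ} {p : MvPolynomial σ F}, p ∈ weightLT F w (r + 1) →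
      weightedHomogeneousComponent w r p ∈ weightLT F w (r + 1) := by
    intro r p hp
    have h1 := Submodule.sub_mem _ hp (weightLT_mono w (Nat.le_succ r) (key hp))
    rwa [sub_sub_cancel] at h1
  have hne : ∀ {r : ℕ} {p : MvPolynomial σ F}, p ∈ weightLT F w (r + 1) → p ∉ weightLT F w r →
      weightedHomogeneousComponent w r p ≠ 0 := by
    intro r p hp hp' h0
    have h1 := key hp
    rw [h0, sub_zero] at h1
    exact hp' h1
  set f₀ := weightedHomogeneousComponent w s f with hf₀
  set g₀ := weightedHomogeneousComponent w t g with hg₀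
  have hmem : f₀ * g₀ ∈ weightLT F w (s + t) := by
    have e : f₀ * g₀ = f * g - f₀ * (g - g₀) - g * (f - f₀) := by ring
    rw [e]
    refine Submodule.sub_mem _ (Submodule.sub_mem _ h (mul_mem_weightLT (hcomp hf) (key hg))) ?_
    rw [add_comm s t]
    exact mul_mem_weightLT hg (key hf)
  obtain ⟨d, hd⟩ := ne_zero_iff.mp (mul_ne_zero (hne hf hf') (hne hg hg'))
  have h1 := ((weightedHomogeneousComponent_isWeightedHomogeneous s f).mul
    (weightedHomogeneousComponent_isWeightedHomogeneous (w := w) t g)) hd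
  have h2 := mem_weightLT.mp hmem d hd
  omega

/-- The operator `T` is multiplication by the monomial `c X^m` up to terms of lower weight. -/
def HasSymbol (w : σ → ℕ) (T : Module.End F (MvPolynomial σ F)) (m : σ →₀ ℕ) (c : F) : Prop :=
  ∀ t, ∀ f ∈ weightLT F w (t + 1), T f - monomial m c * f ∈ weightLT F w (t + Finsupp.weight w m)

theorem HasSymbol.mul {w : σ → ℕ} {S T : Module.End F (MvPolynomial σ F)} {m k : σ →₀ ℕ}
    {c b : F} (hS : HasSymbol w S m c) (hT : HasSymbol w T k b) :
    HasSymbol w (S * T) (m + k) (c * b) := by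
  intro t f hf
  have e : (S * T) f - monomial (m + k) (c * b) * f
      = (S (T f) - monomial m c * T f) + monomial m c * (T f - monomial k b * f) := by
    rw [← monomial_mul, Module.End.mul_apply]
    ring
  have hTf : T f ∈ weightLT F w (t + Finsupp.weight w k + 1) := by
    rw [← sub_add_cancel (T f) (monomial k b * f)]
    exact Submodule.add_mem _ (weightLT_mono w (by omega) (hT t f hf))
      (monomial_mul_mem_weightLT k b hf (by omega))
  rw [e, map_add]
  refine Submodule.add_mem _ (weightLT_mono w (by omega) (hS _ _ hTf)) ?_
  exact monomial_mul_mem_weightLT m c (hT t f hf) (by omega)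

theorem HasSymbol.one (w : σ → ℕ) : HasSymbol w (1 : Module.End F (MvPolynomial σ F)) 0 1 := by
  intro t f _
  have e : (1 : Module.End F (MvPolynomial σ F)) f - monomial 0 1 * f = 0 := by
    rw [Module.End.one_apply, ← C_apply, C_1, one_mul, sub_self]
  rw [e]
  exact Submodule.zero_mem _

theorem HasSymbol.pow {w : σ → ℕ} {T : Module.End F (MvPolynomial σ F)} {m : σ →₀ ℕ} {c : F}
    (hT : HasSymbol w T m c) (k : ℕ) : HasSymbol w (T ^ k) (k • m) (c ^ k) := by
  induction k with
  | zero => simpa using HasSymbol.one w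
  | succ k ih => rw [pow_succ, pow_succ, succ_nsmul]; exact ih.mul hT

theorem HasSymbol.orderedMonomial {w : σ → ℕ} {N : ℕ}
    {T : Fin N → Module.End F (MvPolynomial σ F)} {m : Fin N → σ →₀ ℕ} {c : Fin N → F}
    (hT : ∀ s, HasSymbol w (T s) (m s) (c s)) (γ : Fin N → ℕ) :
    HasSymbol w (orderedMonomial T γ) (∑ s, γ s • m s) (∏ s, c s ^ γ s) := by
  induction N with
  | zero => simpa [Oscillator.orderedMonomial] using HasSymbol.one w
  | succ N ih =>
    rw [orderedMonomial_succ, Fin.sum_univ_succ, Fin.prod_univ_succ]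
    exact ((hT 0).pow _).mul (ih (fun s => hT s.succ) fun s => γ s.succ)

/-- If the symbols of `N` operators are monomials with linearly independent exponents, then the
ordered monomials in these operators send a nonzero polynomial to linearly independent
polynomials: the part of highest weight of a linear combination is the product of a nonzero
polynomial in the symbols with the part of highest weight of the given polynomial. -/
theorem linearIndependent_orderedMonomial {w : σ → ℕ} {N : ℕ}
    {T : Fin N → Module.End F (MvPolynomial σ F)} {m : Fin N → σ →₀ ℕ} {c : Fin N → F}
    (hT : ∀ s, HasSymbol w (T s) (m s) (c s)) (hc : ∀ s, c s ≠ 0)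
    (hm : Function.Injective fun γ : Fin N → ℕ => ∑ s, γ s • m s)
    {f : MvPolynomial σ F} (hf : f ≠ 0) :
    LinearIndependent F fun γ : Fin N → ℕ => orderedMonomial T γ f := by
  classical
  rw [linearIndependent_iff']
  intro S g hg
  by_contra hcon
  push Not at hcon
  obtain ⟨γ₁, hγ₁, hgγ₁⟩ := hcon
  obtain ⟨γ₀, hγ₀, hmax⟩ := (S.filter fun γ => g γ ≠ 0).exists_max_image
    (fun γ => Finsupp.weight w (∑ s, γ s • m s)) ⟨γ₁, by simp [hγ₁, hgγ₁]⟩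
  obtain ⟨hγ₀S, hgγ₀⟩ := Finset.mem_filter.mp hγ₀
  obtain ⟨d₀, hd₀, hdmax⟩ := f.support.exists_max_image (fun d => Finsupp.weight w d)
    (support_nonempty.mpr hf)
  set s := Finsupp.weight w (∑ s, γ₀ s • m s)
  set t := Finsupp.weight w d₀
  let p : MvPolynomial σ F := ∑ γ ∈ S, g γ • monomial (∑ s, γ s • m s) (∏ s, c s ^ γ s)
  have hle : ∀ γ ∈ S, g γ ≠ 0 → Finsupp.weight w (∑ s, γ s • m s) ≤ s := fun γ hγ hγ0 =>
    hmax γ (Finset.mem_filter.mpr ⟨hγ, hγ0⟩)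
  have hfmem : f ∈ weightLT F w (t + 1) := mem_weightLT.mpr fun d hd =>
    Nat.lt_succ_of_le (hdmax d (mem_support_iff.mpr hd))
  have hfnot : f ∉ weightLT F w t := fun h =>
    lt_irrefl _ (mem_weightLT.mp h d₀ (mem_support_iff.mp hd₀))
  have hpmem : p ∈ weightLT F w (s + 1) := by
    refine Submodule.sum_mem _ fun γ hγ => ?_
    by_cases h0 : g γ = 0
    · rw [h0, zero_smul]
      exact Submodule.zero_mem _
    · exact Submodule.smul_mem _ _ (monomial_mem_weightLT _ (Nat.lt_succ_of_le (hle γ hγ h0)))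
  have hpcoeff : coeff (∑ s, γ₀ s • m s) p ≠ 0 := by
    have e : coeff (∑ s, γ₀ s • m s) p = g γ₀ * ∏ s, c s ^ γ₀ s := by
      simp only [p, coeff_sum, coeff_smul, coeff_monomial, smul_eq_mul]
      rw [Finset.sum_eq_single γ₀]
      · rw [if_pos rfl]
      · intro γ _ hne
        rw [if_neg fun h => hne (hm h), mul_zero]
      · exact fun h => absurd hγ₀S h
    rw [e]
    exact mul_ne_zero hgγ₀ (Finset.prod_ne_zero_iff.mpr fun s _ => pow_ne_zero _ (hc s))
  have hpnot : p ∉ weightLT F w s := fun h => lt_irrefl _ (mem_weightLT.mp h _ hpcoeff)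
  refine mul_notMem_weightLT hpmem hfmem hpnot hfnot ?_
  have e : p * f = -∑ γ ∈ S, g γ • (orderedMonomial T γ f
      - monomial (∑ s, γ s • m s) (∏ s, c s ^ γ s) * f) := by
    simp only [smul_sub, Finset.sum_sub_distrib]
    rw [hg, zero_sub, neg_neg, Finset.sum_mul]
    exact Finset.sum_congr rfl fun γ _ => smul_mul_assoc _ _ _
  rw [e]
  refine Submodule.neg_mem _ (Submodule.sum_mem _ fun γ hγ => ?_)
  by_cases h0 : g γ = 0
  · rw [h0, zero_smul]
    exact Submodule.zero_mem _
  · refine Submodule.smul_mem _ _ (weightLT_mono w ?_ (HasSymbol.orderedMonomial hT γ t f hfmem))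
    rw [add_comm]
    exact Nat.add_le_add_right (hle γ hγ h0) t

end Weights

/-! ### Bounds for the modules of harmonic polynomials -/

section Transfer

theorem algHom_mem_of_ι_mem {F L A : Type*} [Field F] [LieRing L] [LieAlgebra F L] [Ring A]
    [Algebra F A] (φ : UniversalEnvelopingAlgebra F L →ₐ[F] A) (B : Subalgebra F A)
    (h : ∀ x : L, φ (UniversalEnvelopingAlgebra.ι F x) ∈ B) (a : UniversalEnvelopingAlgebra F L) :
    φ a ∈ B := by
  obtain ⟨t, rfl⟩ : ∃ t, UniversalEnvelopingAlgebra.mkAlgHom F L t = a := by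
    exact Quotient.exists_rep a
  induction t using TensorAlgebra.induction with
  | algebraMap r => rw [AlgHom.commutes, AlgHom.commutes]; exact B.algebraMap_mem r
  | ι x => exact h x
  | mul a b ha hb => rw [map_mul, map_mul]; exact B.mul_mem ha hb
  | add a b ha hb => rw [map_add, map_add]; exact B.add_mem ha hb

variable (F : Type*) [Field F] {n : ℕ} (n₁ n₂ : ℕ)

theorem envelopingAction_ι (L M : Type*) [LieRing L] [LieAlgebra F L] [AddCommGroup M]
    [Module F M] [LieRingModule L M] [LieModule F L M] (x : L) (m : M) :
    envelopingAction F L M (UniversalEnvelopingAlgebra.ι F x) m = ⁅x, m⁆ := by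
  unfold envelopingAction
  rw [UniversalEnvelopingAlgebra.lift_ι_apply]
  rfl

variable {n₁ n₂}

/-- An element of `harmonic`, as a polynomial. -/
def harmonicVal (h : n₁ ≤ n₂) (l₁ l₂ : ℤ) :
    harmonic F n n₁ n₂ h l₁ l₂ →ₗ[F] MvPolynomial (Fin n ⊕ Fin n) F :=
  (harmonic F n n₁ n₂ h l₁ l₂).toSubmodule.subtype

theorem harmonicVal_injective (h : n₁ ≤ n₂) (l₁ l₂ : ℤ) :
    Function.Injective (harmonicVal F (n := n) h l₁ l₂) := Subtype.val_injective

theorem harmonicVal_lie (h : n₁ ≤ n₂) (l₁ l₂ : ℤ) (A : sl F n)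
    (f : harmonic F n n₁ n₂ h l₁ l₂) :
    harmonicVal F h l₁ l₂ ⁅A, f⁆ = action F n₁ n₂ A.1 (harmonicVal F h l₁ l₂ f) := rfl

theorem action_single (i j : Fin n) :
    action F n₁ n₂ (Matrix.single i j 1) = E F n₁ n₂ i j := by
  change ∑ k, ∑ l, Matrix.single i j (1 : F) k l • E F n₁ n₂ k l = _
  rw [Finset.sum_eq_single i, Finset.sum_eq_single j]
  · rw [Matrix.single_apply_same, one_smul]
  · intro l _ hl
    rw [Matrix.single_apply_of_ne _ _ _ _ _ (fun h => hl h.2.symm), zero_smul]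
  · simp
  · intro k _ hk
    refine Finset.sum_eq_zero fun l _ => ?_
    rw [Matrix.single_apply_of_ne _ _ _ _ _ (fun h => hk h.1.symm), zero_smul]
  · simp

theorem harmonicVal_orderedMonomial (h : n₁ ≤ n₂) (l₁ l₂ : ℤ) {N : ℕ}
    (S : Fin N → Module.End F (harmonic F n n₁ n₂ h l₁ l₂))
    (T : Fin N → Module.End F (MvPolynomial (Fin n ⊕ Fin n) F))
    (hST : ∀ s f, harmonicVal F h l₁ l₂ (S s f) = T s (harmonicVal F h l₁ l₂ f))
    (γ : Fin N → ℕ) (f : harmonic F n n₁ n₂ h l₁ l₂) :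
    harmonicVal F h l₁ l₂ (orderedMonomial S γ f)
      = orderedMonomial T γ (harmonicVal F h l₁ l₂ f) := by
  have hpow : ∀ s k f, harmonicVal F h l₁ l₂ ((S s ^ k) f)
      = (T s ^ k) (harmonicVal F h l₁ l₂ f) := by
    intro s k
    induction k with
    | zero => intro f; rfl
    | succ k ih =>
      intro f
      rw [pow_succ, pow_succ, Module.End.mul_apply, Module.End.mul_apply, ih, hST]
  induction N with
  | zero => simp [orderedMonomial]
  | succ N ih =>
    rw [orderedMonomial_succ, orderedMonomial_succ, Module.End.mul_apply, Module.End.mul_apply,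
      hpow, ih (fun s => S s.succ) (fun s => T s.succ) (fun s => hST s.succ) _
        fun s => hpow s.succ]

/-- Lower bound: if `N` root vectors act with monomial symbols whose exponents are linearly
independent, then a nonzero module of harmonic polynomials has dimension at least `N`. -/
theorem le_gkDim_harmonic (h : n₁ ≤ n₂) (l₁ l₂ : ℤ)
    [Nontrivial (harmonic F n n₁ n₂ h l₁ l₂)]
    (V : Submodule F (UniversalEnvelopingAlgebra F (sl F n))) (hV : IsGeneratingSpace V)
    (M₀ : Submodule F (harmonic F n n₁ n₂ h l₁ l₂))
    (hM₀ : IsModuleGeneratingSpace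
      (envelopingAction F (sl F n) (harmonic F n n₁ n₂ h l₁ l₂)) M₀)
    {N : ℕ} (w : Fin n ⊕ Fin n → ℕ) (i j : Fin N → Fin n) (hij : ∀ s, i s ≠ j s)
    (m : Fin N → (Fin n ⊕ Fin n) →₀ ℕ) (c : Fin N → F) (hc : ∀ s, c s ≠ 0)
    (hE : ∀ s, HasSymbol w (E F n₁ n₂ (i s) (j s)) (m s) (c s))
    (hm : Function.Injective fun γ : Fin N → ℕ => ∑ s, γ s • m s) :
    ((N : ℝ) : EReal) ≤
      gkDim (envelopingAction F (sl F n) (harmonic F n n₁ n₂ h l₁ l₂)) V M₀ := by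
  have := hM₀.1
  obtain ⟨f, hf, hf0⟩ : ∃ f ∈ M₀, f ≠ 0 := by
    by_contra hcon
    push Not at hcon
    have h0 : M₀ = ⊥ := (Submodule.eq_bot_iff _).mpr hcon
    have h1 := hM₀.2
    rw [h0, actOn, Submodule.map₂_bot_right] at h1
    exact bot_ne_top h1
  refine le_gkDim _ V hV M₀ N
    (fun s => UniversalEnvelopingAlgebra.ι F
      (LieAlgebra.SpecialLinear.single (i s) (j s) (hij s) (1 : F))) f hf ?_
  refine LinearIndependent.of_comp (harmonicVal F h l₁ l₂) ?_
  have h1 := linearIndependent_orderedMonomial hE hc hm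
    (f := harmonicVal F h l₁ l₂ f) fun h0 => hf0 (harmonicVal_injective F h l₁ l₂ (by
      rw [h0, map_zero]))
  convert h1 using 1
  funext γ
  have e := map_orderedMonomial (MonoidHomClass.toMonoidHom
    (envelopingAction F (sl F n) (harmonic F n n₁ n₂ h l₁ l₂)))
    (fun s => UniversalEnvelopingAlgebra.ι F
      (LieAlgebra.SpecialLinear.single (i s) (j s) (hij s) (1 : F))) γ
  have e' : envelopingAction F (sl F n) (harmonic F n n₁ n₂ h l₁ l₂) (orderedMonomial
      (fun s => UniversalEnvelopingAlgebra.ι F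
        (LieAlgebra.SpecialLinear.single (i s) (j s) (hij s) (1 : F))) γ) = _ := e
  rw [Function.comp_apply, e']
  refine harmonicVal_orderedMonomial F h l₁ l₂ _ _ (fun s g => ?_) γ f
  change harmonicVal F h l₁ l₂ (envelopingAction F (sl F n) (harmonic F n n₁ n₂ h l₁ l₂) _ g) = _
  rw [envelopingAction_ι, harmonicVal_lie, LieAlgebra.SpecialLinear.val_single, action_single]
  rfl

theorem mulX_mem_boundedShift (w : Fin n ⊕ Fin n → ℕ) (v : Fin n ⊕ Fin n) :
    (mulX F v : Module.End F (MvPolynomial (Fin n ⊕ Fin n) F)) ∈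
      boundedShift (weightLT F w) (weightLT_mono w) :=
  ⟨w v, fun _ _ hf => X_mul_mem_weightLT v hf le_rfl⟩

theorem del_mem_boundedShift (w : Fin n ⊕ Fin n → ℕ) (v : Fin n ⊕ Fin n) :
    (del F v : Module.End F (MvPolynomial (Fin n ⊕ Fin n) F)) ∈
      boundedShift (weightLT F w) (weightLT_mono w) :=
  ⟨0, fun _ _ hf => pderiv_mem_weightLT v hf⟩

theorem action_mem_boundedShift (w : Fin n ⊕ Fin n → ℕ) (A : Matrix (Fin n) (Fin n) F) :
    (action F n₁ n₂ A : Module.End F (MvPolynomial (Fin n ⊕ Fin n) F)) ∈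
      boundedShift (weightLT F w) (weightLT_mono w) := by
  have hQ : ∀ v, (Q F n₁ n₂ v : Module.End F (MvPolynomial (Fin n ⊕ Fin n) F)) ∈
      boundedShift (weightLT F w) (weightLT_mono w) := by
    intro v
    unfold Q
    split_ifs
    · exact del_mem_boundedShift F w v
    · exact mulX_mem_boundedShift F w v
  have hP : ∀ v, (P F n₁ n₂ v : Module.End F (MvPolynomial (Fin n ⊕ Fin n) F)) ∈
      boundedShift (weightLT F w) (weightLT_mono w) := by
    intro v
    unfold P
    split_ifs
    · exact neg_mem (mulX_mem_boundedShift F w v)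
    · exact del_mem_boundedShift F w v
  have hE : ∀ i j, (E F n₁ n₂ i j : Module.End F (MvPolynomial (Fin n ⊕ Fin n) F)) ∈
      boundedShift (weightLT F w) (weightLT_mono w) := by
    intro i j
    rw [E_eq]
    exact sub_mem (mul_mem (hQ _) (hP _)) (mul_mem (hQ _) (hP _))
  exact sum_mem (S := boundedShift (weightLT F w) (weightLT_mono w)) fun i _ =>
    sum_mem (S := boundedShift (weightLT F w) (weightLT_mono w)) fun j _ =>
      (boundedShift (weightLT F w) (weightLT_mono w)).smul_mem (hE i j) (A i j)

theorem finrank_le_of_coeff {M σ : Type*} [AddCommGroup M] [Module F M]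
    (e : M →ₗ[F] MvPolynomial σ F) (K : Submodule F M) (S : Finset (σ →₀ ℕ))
    (h : ∀ f ∈ K, (∀ d ∈ S, coeff d (e f) = 0) → f = 0) : Module.finrank F K ≤ S.card := by
  let g : K →ₗ[F] (S → F) := LinearMap.pi fun d => (lcoeff F (d : σ →₀ ℕ)) ∘ₗ e ∘ₗ K.subtype
  have hg : Function.Injective g := by
    rw [injective_iff_map_eq_zero]
    intro f hf
    exact Subtype.ext (h f f.2 fun d hd => congrFun hf ⟨d, hd⟩)
  simpa using LinearMap.finrank_le_finrank_of_injective hg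

/-- A count of exponents that are at most `t` on `J`, at most `L` off `J` and `a`, and determined by
their values off `a`: for fixed `L` it is polynomial in `t` of degree `J.card`. -/
theorem card_exponents_le {σ : Type*} [Fintype σ] [DecidableEq σ] (S : Finset (σ →₀ ℕ))
    (J : Finset σ) (a : σ) (t L : ℕ) (hJ : ∀ d ∈ S, ∀ v ∈ J, d v ≤ t)
    (hL : ∀ d ∈ S, ∀ v ∉ J, v ≠ a → d v ≤ L)
    (hinj : ∀ d ∈ S, ∀ d' ∈ S, (∀ v ≠ a, d v = d' v) → d = d') :
    S.card ≤ (L + 1) ^ Fintype.card σ * (t + 1) ^ J.card := by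
  let B : Finset (σ → ℕ) := Fintype.piFinset fun v =>
    if v ∈ J then Finset.range (t + 1) else Finset.range (L + 1)
  have hB : B.card ≤ (L + 1) ^ Fintype.card σ * (t + 1) ^ J.card := by
    calc B.card = ∏ v, if v ∈ J then t + 1 else L + 1 := by
          rw [Fintype.card_piFinset]
          refine Finset.prod_congr rfl fun v _ => ?_
          split_ifs <;> simp
      _ ≤ ∏ v, (L + 1) * if v ∈ J then t + 1 else 1 := by
          refine Finset.prod_le_prod' fun v _ => ?_
          split_ifs
          · exact Nat.le_mul_of_pos_left _ (Nat.succ_pos _)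
          · rw [mul_one]
      _ = _ := by
          rw [Finset.prod_mul_distrib, Finset.prod_const, Finset.prod_ite_mem,
            Finset.univ_inter, Finset.prod_const, Finset.card_univ]
  refine le_trans (Finset.card_le_card_of_injOn (fun d v => if v = a then 0 else d v) ?_ ?_) hB
  · intro d hd
    refine Finset.mem_coe.mpr (Fintype.mem_piFinset.mpr fun v => ?_)
    by_cases hva : v = a
    · simp only [hva, if_true]
      split_ifs <;> simp
    · simp only [hva, if_false]
      split_ifs with hv
      · exact Finset.mem_range.mpr (Nat.lt_succ_of_le (hJ d hd v hv))
      · exact Finset.mem_range.mpr (Nat.lt_succ_of_le (hL d hd v hv hva))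
  · intro d hd d' hd' hdd
    refine hinj d hd d' hd' fun v hv => ?_
    simpa [hv] using congrFun hdd v

/-- Upper bound: the coefficients at the exponents in `S` determine a harmonic polynomial, and
these exponents have `J.card` unbounded coordinates besides the one at `a`, which is determined
by the others. -/
theorem gkDim_harmonic_le (h : n₁ ≤ n₂) (l₁ l₂ : ℤ)
    (V : Submodule F (UniversalEnvelopingAlgebra F (sl F n))) (hV : IsGeneratingSpace V)
    (M₀ : Submodule F (harmonic F n n₁ n₂ h l₁ l₂))
    (hM₀ : IsModuleGeneratingSpace
      (envelopingAction F (sl F n) (harmonic F n n₁ n₂ h l₁ l₂)) M₀)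
    (S : Set ((Fin n ⊕ Fin n) →₀ ℕ)) (J : Finset (Fin n ⊕ Fin n)) (a : Fin n ⊕ Fin n) (L : ℕ)
    (hS : ∀ f, (∀ d ∈ S, coeff d (harmonicVal F h l₁ l₂ f) = 0) → f = 0)
    (hL : ∀ d ∈ S, ∀ v ∉ J, v ≠ a → d v ≤ L)
    (hinj : ∀ d ∈ S, ∀ d' ∈ S, (∀ v ≠ a, d v = d' v) → d = d') :
    gkDim (envelopingAction F (sl F n) (harmonic F n n₁ n₂ h l₁ l₂)) V M₀ ≤
      ((J.card : ℝ) : EReal) := by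
  classical
  have := hV.1
  have := hM₀.1
  let w : Fin n ⊕ Fin n → ℕ := fun _ => 1
  have hmono : Monotone fun t => (weightLT F w t).comap (harmonicVal F (n := n) h l₁ l₂) :=
    fun s t hst => Submodule.comap_mono (weightLT_mono w hst)
  refine gkDim_le_of_filtration _ V M₀ _ hmono
    (fun f => exists_mem_weightLT w (harmonicVal F h l₁ l₂ f)) ?_ J.card
    ((L + 1) ^ Fintype.card (Fin n ⊕ Fin n)) ?_
  · refine algHom_mem_of_ι_mem _ _ fun A => ?_
    obtain ⟨c, hc⟩ := action_mem_boundedShift F (n₁ := n₁) (n₂ := n₂) w A.1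
    refine ⟨c, fun t f hf => ?_⟩
    rw [Submodule.mem_comap, envelopingAction_ι, harmonicVal_lie]
    exact hc t _ hf
  · intro t K hK
    have hfin : {d : (Fin n ⊕ Fin n) →₀ ℕ | d ∈ S ∧ Finsupp.weight w d < t}.Finite := by
      refine (Finsupp.finite_of_degree_le (σ := Fin n ⊕ Fin n) t).subset fun d hd => ?_
      have h1 : Finsupp.weight w d = d.degree := (DFunLike.congr_fun
        (Finsupp.degree_eq_weight_one (σ := Fin n ⊕ Fin n) (R := ℕ)) d).symm
      have h2 := hd.2
      rw [h1] at h2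
      exact h2.le
    refine (finrank_le_of_coeff F (harmonicVal F h l₁ l₂) K hfin.toFinset ?_).trans
      (card_exponents_le _ J a t L ?_ ?_ ?_)
    · intro f hf hcoeff
      refine hS f fun d hd => ?_
      by_contra hne
      exact hne (hcoeff d (hfin.mem_toFinset.mpr ⟨hd, mem_weightLT.mp (hK hf) d hne⟩))
    · intro d hd v _
      have h1 := (hfin.mem_toFinset.mp hd).2
      exact (Finsupp.le_weight w (s := v) one_ne_zero d).trans h1.le
    · exact fun d hd => hL d (hfin.mem_toFinset.mp hd).1
    · exact fun d hd d' hd' => hinj d (hfin.mem_toFinset.mp hd).1 d' (hfin.mem_toFinset.mp hd').1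

end Transfer

/-! ### Upper bounds -/

section UpperBounds

variable (F : Type*) [Field F] {n n₁ n₂ : ℕ}

theorem coeff_harmonicVal_eq_zero (h : n₁ ≤ n₂) (l₁ l₂ : ℤ) (f : harmonic F n n₁ n₂ h l₁ l₂)
    {d : (Fin n ⊕ Fin n) →₀ ℕ} (hd : ¬(deg₁ n₁ d = l₁ ∧ deg₂ n₂ d = l₂)) :
    coeff d (harmonicVal F h l₁ l₂ f) = 0 := by
  have hle : bigraded F n n₁ n₂ l₁ l₂ ≤
      (restrictSupport F {d : (Fin n ⊕ Fin n) →₀ ℕ | deg₁ n₁ d = l₁ ∧ deg₂ n₂ d = l₂} :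
        Submodule F (MvPolynomial (Fin n ⊕ Fin n) F)) := by
    refine Submodule.span_le.mpr ?_
    rintro _ ⟨e, he₁, he₂, rfl⟩
    exact (monomial_mem_restrictSupport F).mpr (Or.inl ⟨he₁, he₂⟩)
  have hf : harmonicVal F h l₁ l₂ f ∈ restrictSupport F
      {d : (Fin n ⊕ Fin n) →₀ ℕ | deg₁ n₁ d = l₁ ∧ deg₂ n₂ d = l₂} := hle f.2.1
  by_contra hne
  exact hd ((mem_restrictSupport_iff F).mp hf (mem_support_iff.mpr hne))

/-- A polynomial killed by the vector field `X_a ∂_b + ∑ X_{u s} ∂_{v s}`, in which `X_b` and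
`∂_b` do not occur otherwise, is determined by its restriction to the hyperplane `X_b = 0`: by
induction on `k`, its coefficients at exponents with `b`-th entry `k` vanish. -/
theorem eq_zero_of_vectorField {σ ι : Type*} [CharZero F] {a b : σ} (hab : a ≠ b)
    (I : Finset ι) (u v : ι → σ) (hu : ∀ s ∈ I, u s ≠ b) (hv : ∀ s ∈ I, v s ≠ b)
    (f : MvPolynomial σ F)
    (hD : X a * pderiv b f + ∑ s ∈ I, X (u s) * pderiv (v s) f = 0)
    (h0 : ∀ d, d b = 0 → coeff d f = 0) : f = 0 := by
  classical
  have key : ∀ k, ∀ d : σ →₀ ℕ, d b = k → coeff d f = 0 := by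
    intro k
    induction k with
    | zero => exact h0
    | succ k ih =>
      intro d hd
      obtain ⟨e, rfl⟩ : ∃ e, d = e + Finsupp.single b 1 :=
        ⟨d - Finsupp.single b 1, (tsub_add_cancel_of_le
          (Finsupp.single_le_iff.mpr (by omega))).symm⟩
      have he : e b = k := by simpa using hd
      have hc := congrArg (coeff (Finsupp.single a 1 + e)) hD
      rw [coeff_add, coeff_X_mul, coeff_pderiv, coeff_sum, coeff_zero,
        Finset.sum_eq_zero, add_zero] at hc
      · exact (mul_eq_zero.mp hc).resolve_right (Nat.cast_add_one_ne_zero _)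
      · intro s hs
        rw [coeff_X_mul']
        split_ifs
        · rw [coeff_pderiv, ih, zero_mul]
          simp [hab, hu s hs, hv s hs, he]
        · rfl
  exact MvPolynomial.ext _ _ fun d => by rw [key _ d rfl, coeff_zero]

/-- For `n₁ = n₂` the deformed Laplace operator is, up to sign, a vector field with one term for
every index. -/
theorem sum_vectorField_harmonicVal {p : ℕ} (l₁ l₂ : ℤ) (f : harmonic F n p p le_rfl l₁ l₂) :
    ∑ k : Fin n, X (if (k : ℕ) < p then Sum.inl k else Sum.inr k) *
      pderiv (if (k : ℕ) < p then Sum.inr k else Sum.inl k) (harmonicVal F le_rfl l₁ l₂ f) = 0 := by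
  have hf : laplace F n p p (harmonicVal F le_rfl l₁ l₂ f) = 0 := f.2.2
  have e : ∀ g : Poly F n, laplace F n p p g = -∑ k : Fin n,
      if (k : ℕ) < p then (x F k * dy F k) g else (y F k * dx F k) g := by
    intro g
    have hempty : (Finset.univ.filter fun r : Fin n => p ≤ (r : ℕ) ∧ (r : ℕ) < p) = ∅ :=
      Finset.filter_eq_empty_iff.mpr fun r _ hr => by omega
    unfold laplace
    rw [hempty, Finset.sum_empty, add_zero, Finset.sum_ite, LinearMap.sub_apply,
      LinearMap.neg_apply, LinearMap.sum_apply, LinearMap.sum_apply, neg_add, sub_eq_add_neg]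
    simp only [not_lt]
  have hf' := (e _).symm.trans hf
  rw [neg_eq_zero] at hf'
  refine (Finset.sum_congr rfl fun k _ => ?_).trans hf'
  split_ifs <;> rfl

theorem harmonic_eq_zero_of_coeff [CharZero F] {p : ℕ} (l₁ l₂ : ℤ) (k₀ : Fin n)
    (f : harmonic F n p p le_rfl l₁ l₂)
    (h0 : ∀ d, d (if (k₀ : ℕ) < p then Sum.inr k₀ else Sum.inl k₀) = 0 →
      coeff d (harmonicVal F le_rfl l₁ l₂ f) = 0) : f = 0 := by
  have hsum := sum_vectorField_harmonicVal F l₁ l₂ f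
  rw [← Finset.add_sum_erase _ _ (Finset.mem_univ k₀)] at hsum
  refine harmonicVal_injective F le_rfl l₁ l₂ ((eq_zero_of_vectorField F ?_ _ _ _ ?_ ?_ _ hsum
    h0).trans (map_zero _).symm)
  · split_ifs <;> simp
  · intro s hs
    have := Finset.ne_of_mem_erase hs
    split_ifs <;> simp [this]
  · intro s hs
    have := Finset.ne_of_mem_erase hs
    split_ifs <;> simp [this]

theorem deg₁_eq_sum (d : (Fin n ⊕ Fin n) →₀ ℕ) :
    deg₁ n₁ d = ∑ i : Fin n, (if (i : ℕ) < n₁ then -1 else 1) * (d (Sum.inl i) : ℤ) := by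
  rw [deg₁, Finset.sum_filter, Finset.sum_filter, ← Finset.sum_sub_distrib]
  refine Finset.sum_congr rfl fun i _ => ?_
  by_cases hi : (i : ℕ) < n₁
  · simp [hi, not_le.mpr hi]
  · simp [hi, not_lt.mp hi]

theorem deg₂_eq_sum (d : (Fin n ⊕ Fin n) →₀ ℕ) :
    deg₂ n₂ d = ∑ i : Fin n, (if (i : ℕ) < n₂ then 1 else -1) * (d (Sum.inr i) : ℤ) := by
  rw [deg₂, Finset.sum_filter, Finset.sum_filter, ← Finset.sum_sub_distrib]
  refine Finset.sum_congr rfl fun i _ => ?_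
  by_cases hi : (i : ℕ) < n₂
  · simp [hi, not_le.mpr hi]
  · simp [hi, not_lt.mp hi]

theorem eq_of_deg₁_eq {d d' : (Fin n ⊕ Fin n) →₀ ℕ} (k : Fin n)
    (hdeg : deg₁ n₁ d = deg₁ n₁ d') (h : ∀ v ≠ Sum.inl k, d v = d' v) : d = d' := by
  rw [deg₁_eq_sum, deg₁_eq_sum, ← Finset.add_sum_erase _ _ (Finset.mem_univ k),
    ← Finset.add_sum_erase _ _ (Finset.mem_univ k)] at hdeg
  rw [Finset.sum_congr rfl fun i hi => by
    rw [h (Sum.inl i) (by simpa using Finset.ne_of_mem_erase hi)]] at hdeg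
  refine Finsupp.ext fun v => ?_
  by_cases hv : v = Sum.inl k
  · subst hv
    split_ifs at hdeg <;> omega
  · exact h v hv

theorem eq_of_deg₂_eq {d d' : (Fin n ⊕ Fin n) →₀ ℕ} (k : Fin n)
    (hdeg : deg₂ n₂ d = deg₂ n₂ d') (h : ∀ v ≠ Sum.inr k, d v = d' v) : d = d' := by
  rw [deg₂_eq_sum, deg₂_eq_sum, ← Finset.add_sum_erase _ _ (Finset.mem_univ k),
    ← Finset.add_sum_erase _ _ (Finset.mem_univ k)] at hdeg
  rw [Finset.sum_congr rfl fun i hi => by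
    rw [h (Sum.inr i) (by simpa using Finset.ne_of_mem_erase hi)]] at hdeg
  refine Finsupp.ext fun v => ?_
  by_cases hv : v = Sum.inr k
  · subst hv
    split_ifs at hdeg <;> omega
  · exact h v hv

/-- Summands of a signed sum of natural numbers are bounded by the absolute value of the sum if
the nonzero summands all have the same sign. -/
theorem le_natAbs_of_signed_sum {ι : Type*} [Fintype ι] (ε : ι → ℤ) (e : ℤ)
    (he : e = 1 ∨ e = -1) (d : ι → ℕ) (l : ℤ) (h : ∑ i, ε i * (d i : ℤ) = l)
    (hε : ∀ i, ε i = e ∨ d i = 0) (i : ι) : d i ≤ l.natAbs := by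
  have h1 : l = e * ∑ i, (d i : ℤ) := by
    rw [← h, Finset.mul_sum]
    refine Finset.sum_congr rfl fun i _ => ?_
    rcases hε i with h | h <;> simp [h]
  have h2 : (d i : ℤ) ≤ ∑ i, (d i : ℤ) :=
    Finset.single_le_sum (f := fun i => (d i : ℤ)) (fun i _ => Int.natCast_nonneg _)
      (Finset.mem_univ i)
  rcases he with rfl | rfl <;> omega

variable (h : n₁ ≤ n₂) (l₁ l₂ : ℤ)
  (V : Submodule F (UniversalEnvelopingAlgebra F (sl F n))) (hV : IsGeneratingSpace V)
  (M₀ : Submodule F (harmonic F n n₁ n₂ h l₁ l₂))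
  (hM₀ : IsModuleGeneratingSpace
    (envelopingAction F (sl F n) (harmonic F n n₁ n₂ h l₁ l₂)) M₀)

include hV hM₀

/-- If `n₂ = n`, then the exponents of all `y_i` are bounded. -/
theorem gkDim_harmonic_le_of_eq (hn : 0 < n) (h₂ : n₂ = n) :
    gkDim (envelopingAction F (sl F n) (harmonic F n n₁ n₂ h l₁ l₂)) V M₀ ≤
      (((n - 1 : ℕ) : ℝ) : EReal) := by
  let k₀ : Fin n := ⟨0, hn⟩
  have hJ : ((Finset.univ.erase k₀).map Function.Embedding.inl :
      Finset (Fin n ⊕ Fin n)).card = n - 1 := by simp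
  rw [← hJ]
  refine gkDim_harmonic_le F h l₁ l₂ V hV M₀ hM₀ {d | deg₁ n₁ d = l₁ ∧ deg₂ n₂ d = l₂} _
    (Sum.inl k₀) l₂.natAbs ?_ ?_ ?_
  · intro f hf
    refine harmonicVal_injective F h l₁ l₂ (MvPolynomial.ext _ _ fun d => ?_)
    rw [map_zero, coeff_zero]
    by_cases hd : deg₁ n₁ d = l₁ ∧ deg₂ n₂ d = l₂
    · exact hf d hd
    · exact coeff_harmonicVal_eq_zero F h l₁ l₂ f hd
  · rintro d ⟨-, hd⟩ (i | i) hi hi'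
    · simp_all
    · rw [deg₂_eq_sum] at hd
      refine le_natAbs_of_signed_sum _ 1 (Or.inl rfl) (fun i => d (Sum.inr i)) l₂ hd (fun i => ?_) i
      rw [if_pos (by omega)]
      exact Or.inl rfl
  · intro d hd d' hd' hdd
    exact eq_of_deg₁_eq k₀ (hd.1.trans hd'.1.symm) hdd

/-- If `n₁ = n₂ = n`, then `H_{⟨ℓ₁,ℓ₂⟩}` is finite-dimensional. -/
theorem gkDim_harmonic_le_zero (hn : 0 < n) (h₁ : n₁ = n) :
    gkDim (envelopingAction F (sl F n) (harmonic F n n₁ n₂ h l₁ l₂)) V M₀ ≤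
      (((0 : ℕ) : ℝ) : EReal) := by
  rw [← Finset.card_empty (α := Fin n ⊕ Fin n)]
  refine gkDim_harmonic_le F h l₁ l₂ V hV M₀ hM₀ {d | deg₁ n₁ d = l₁ ∧ deg₂ n₂ d = l₂} _
    (Sum.inl ⟨0, hn⟩) (l₁.natAbs + l₂.natAbs) ?_ ?_ ?_
  · intro f hf
    refine harmonicVal_injective F h l₁ l₂ (MvPolynomial.ext _ _ fun d => ?_)
    rw [map_zero, coeff_zero]
    by_cases hd : deg₁ n₁ d = l₁ ∧ deg₂ n₂ d = l₂
    · exact hf d hd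
    · exact coeff_harmonicVal_eq_zero F h l₁ l₂ f hd
  · rintro d ⟨hd₁, hd₂⟩ (i | i) - -
    · rw [deg₁_eq_sum] at hd₁
      refine (le_natAbs_of_signed_sum _ (-1) (Or.inr rfl) (fun i => d (Sum.inl i)) l₁ hd₁
        (fun i => ?_) i).trans (Nat.le_add_right _ _)
      rw [if_pos (by omega)]
      exact Or.inl rfl
    · rw [deg₂_eq_sum] at hd₂
      refine (le_natAbs_of_signed_sum _ 1 (Or.inl rfl) (fun i => d (Sum.inr i)) l₂ hd₂
        (fun i => ?_) i).trans (Nat.le_add_left _ _)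
      rw [if_pos (by omega)]
      exact Or.inl rfl
  · intro d hd d' hd' hdd
    exact eq_of_deg₁_eq _ (hd.1.trans hd'.1.symm) hdd

/-- If `n₁ = n₂ = 1`, then harmonic polynomials are determined by their restriction to `y₁ = 0`,
where the exponents of the `y_i` are bounded. -/
theorem gkDim_harmonic_le_of_one [CharZero F] (hn : 0 < n) (h₁ : n₁ = 1) (h₂ : n₂ = 1) :
    gkDim (envelopingAction F (sl F n) (harmonic F n n₁ n₂ h l₁ l₂)) V M₀ ≤
      (((n - 1 : ℕ) : ℝ) : EReal) := by
  subst h₁ h₂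
  let k₀ : Fin n := ⟨0, hn⟩
  have hk₀ : (k₀ : ℕ) < 1 := Nat.zero_lt_one
  have hJ : ((Finset.univ.erase k₀).map Function.Embedding.inl :
      Finset (Fin n ⊕ Fin n)).card = n - 1 := by simp
  rw [← hJ]
  refine gkDim_harmonic_le F h l₁ l₂ V hV M₀ hM₀
    {d | deg₁ 1 d = l₁ ∧ deg₂ 1 d = l₂ ∧ d (Sum.inr k₀) = 0} _ (Sum.inl k₀) l₂.natAbs ?_ ?_ ?_
  · intro f hf
    refine harmonic_eq_zero_of_coeff F l₁ l₂ k₀ f fun d hd => ?_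
    rw [if_pos hk₀] at hd
    by_cases hdeg : deg₁ 1 d = l₁ ∧ deg₂ 1 d = l₂
    · exact hf d ⟨hdeg.1, hdeg.2, hd⟩
    · exact coeff_harmonicVal_eq_zero F h l₁ l₂ f hdeg
  · rintro d ⟨-, hd, hd0⟩ (i | i) hi hi'
    · simp_all
    · rw [deg₂_eq_sum] at hd
      refine le_natAbs_of_signed_sum _ (-1) (Or.inr rfl) (fun i => d (Sum.inr i)) l₂ hd
        (fun i => ?_) i
      by_cases hik : (i : ℕ) < 1
      · have : i = k₀ := Fin.ext (by simpa [k₀] using hik)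
        exact Or.inr (this ▸ hd0)
      · rw [if_neg hik]
        exact Or.inl rfl
  · intro d hd d' hd' hdd
    exact eq_of_deg₁_eq k₀ (hd.1.trans hd'.1.symm) hdd

/-- If `n₁ = n₂ = n - 1`, then harmonic polynomials are determined by their restriction to
`x_n = 0`, where the exponents of the `x_i` are bounded. -/
theorem gkDim_harmonic_le_of_pred [CharZero F] (hn : 0 < n) (h₁ : n₁ = n - 1) (h₂ : n₂ = n - 1) :
    gkDim (envelopingAction F (sl F n) (harmonic F n n₁ n₂ h l₁ l₂)) V M₀ ≤
      (((n - 1 : ℕ) : ℝ) : EReal) := by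
  subst h₁ h₂
  let k₀ : Fin n := ⟨n - 1, by omega⟩
  have hk₀ : ¬(k₀ : ℕ) < n - 1 := lt_irrefl _
  have hJ : ((Finset.univ.erase k₀).map Function.Embedding.inr :
      Finset (Fin n ⊕ Fin n)).card = n - 1 := by simp
  have hgoal : gkDim (envelopingAction F (sl F n) (harmonic F n (n - 1) (n - 1) h l₁ l₂)) V M₀ ≤
      ((((Finset.univ.erase k₀).map Function.Embedding.inr :
        Finset (Fin n ⊕ Fin n)).card : ℝ) : EReal) := by
    refine gkDim_harmonic_le F h l₁ l₂ V hV M₀ hM₀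
      {d | deg₁ (n - 1) d = l₁ ∧ deg₂ (n - 1) d = l₂ ∧ d (Sum.inl k₀) = 0} _ (Sum.inr k₀)
      l₁.natAbs ?_ ?_ ?_
    · intro f hf
      refine harmonic_eq_zero_of_coeff F l₁ l₂ k₀ f fun d hd => ?_
      rw [if_neg hk₀] at hd
      by_cases hdeg : deg₁ (n - 1) d = l₁ ∧ deg₂ (n - 1) d = l₂
      · exact hf d ⟨hdeg.1, hdeg.2, hd⟩
      · exact coeff_harmonicVal_eq_zero F h l₁ l₂ f hdeg
    · rintro d ⟨hd, -, hd0⟩ (i | i) hi hi'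
      · rw [deg₁_eq_sum] at hd
        refine le_natAbs_of_signed_sum _ (-1) (Or.inr rfl) (fun i => d (Sum.inl i)) l₁ hd
          (fun i => ?_) i
        by_cases hik : (i : ℕ) < n - 1
        · rw [if_pos hik]
          exact Or.inl rfl
        · have : i = k₀ := Fin.ext (by
            have := i.2
            change (i : ℕ) = n - 1
            omega)
          exact Or.inr (this ▸ hd0)
      · simp_all
    · intro d hd d' hd' hdd
      exact eq_of_deg₂_eq k₀ (hd.2.1.trans hd'.2.1.symm) hdd
  rwa [hJ] at hgoal

end UpperBounds

/-! ### Lower bounds -/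

section LowerBounds

variable (F : Type*) [Field F] {n n₁ n₂ : ℕ}

theorem hasSymbol_of_eq {σ : Type*} {w : σ → ℕ} {T R : Module.End F (MvPolynomial σ F)}
    {u v : σ} (c : F) (hT : ∀ f, T f = c • (X u * (X v * f)) + R f)
    (hR : ∀ t, ∀ f ∈ weightLT F w (t + 1), R f ∈ weightLT F w (t + (w u + w v))) :
    HasSymbol w T (Finsupp.single u 1 + Finsupp.single v 1) c := by
  intro t f hf
  have e : monomial (Finsupp.single u 1 + Finsupp.single v 1) c * f = c • (X u * (X v * f)) := by
    rw [← mul_assoc, X, X, monomial_mul, ← smul_mul_assoc, smul_monomial]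
    simp
  rw [hT, e, add_sub_cancel_left]
  simpa [Finsupp.weight_single] using hR t f hf

/-- For `j ≤ n₁ < i` the operator `E_{i,j}` is multiplication by `-x_i x_j` plus a term of lower
weight if the weights of the `x` variables are large. -/
theorem hasSymbol_E_inl (h : n₁ ≤ n₂) {w : Fin n ⊕ Fin n → ℕ} {i j : Fin n} (hj : (j : ℕ) < n₁)
    (hi : n₁ ≤ (i : ℕ))
    (hw : w (Sum.inr i) + w (Sum.inr j) < w (Sum.inl i) + w (Sum.inl j)) :
    HasSymbol w (E F n₁ n₂ i j) (Finsupp.single (Sum.inl i) 1 + Finsupp.single (Sum.inl j) 1)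
      (-1 : F) := by
  have hj₂ : (j : ℕ) < n₂ := lt_of_lt_of_le hj h
  refine hasSymbol_of_eq F (R := -Ey F n₂ j i) (-1) (fun f => ?_) fun t f hf => ?_
  · have e : E F n₁ n₂ i j = (-1 : F) • (x F i * x F j) + -Ey F n₂ j i := by
      rw [E, Ex, if_neg (not_lt.mpr hi), if_pos hj, neg_one_smul, sub_eq_add_neg]
    exact congrArg (fun T : Module.End F (Poly F n) => T f) e
  · refine Submodule.neg_mem _ ?_
    by_cases hi₂ : (i : ℕ) < n₂
    · have e : Ey F n₂ j i = y F j * dy F i := by rw [Ey, if_pos hj₂, if_pos hi₂]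
      rw [e]
      exact X_mul_mem_weightLT (Sum.inr j) (pderiv_mem_weightLT (Sum.inr i) hf) (by omega)
    · have e : Ey F n₂ j i = -(y F j * y F i) := by rw [Ey, if_pos hj₂, if_neg hi₂]
      rw [e]
      exact Submodule.neg_mem _ (X_mul_mem_weightLT (Sum.inr j)
        (X_mul_mem_weightLT (Sum.inr i) hf le_rfl) (by omega))

/-- For `j ≤ n₂ < i` the operator `E_{i,j}` is multiplication by `y_i y_j` plus a term of lower
weight if the weights of the `y` variables are large. -/
theorem hasSymbol_E_inr (h : n₁ ≤ n₂) {w : Fin n ⊕ Fin n → ℕ} {i j : Fin n} (hj : (j : ℕ) < n₂)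
    (hi : n₂ ≤ (i : ℕ))
    (hw₁ : (j : ℕ) < n₁ → w (Sum.inl i) + w (Sum.inl j) < w (Sum.inr i) + w (Sum.inr j))
    (hw₂ : n₁ ≤ (j : ℕ) → w (Sum.inl i) < w (Sum.inr i) + w (Sum.inr j)) :
    HasSymbol w (E F n₁ n₂ i j) (Finsupp.single (Sum.inr j) 1 + Finsupp.single (Sum.inr i) 1)
      (1 : F) := by
  have hi₁ : ¬(i : ℕ) < n₁ := not_lt.mpr (h.trans hi)
  refine hasSymbol_of_eq F (R := Ex F n₁ i j) 1 (fun f => ?_) fun t f hf => ?_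
  · have e : E F n₁ n₂ i j = (1 : F) • (y F j * y F i) + Ex F n₁ i j := by
      rw [E, Ey, if_pos hj, if_neg (not_lt.mpr hi), one_smul, sub_neg_eq_add, add_comm]
    exact congrArg (fun T : Module.End F (Poly F n) => T f) e
  · by_cases hj₁ : (j : ℕ) < n₁
    · have e : Ex F n₁ i j = -(x F i * x F j) := by rw [Ex, if_neg hi₁, if_pos hj₁]
      rw [e]
      have := hw₁ hj₁
      exact Submodule.neg_mem _ (X_mul_mem_weightLT (Sum.inl i)
        (X_mul_mem_weightLT (Sum.inl j) hf le_rfl) (by omega))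
    · have e : Ex F n₁ i j = x F i * dx F j := by rw [Ex, if_neg hi₁, if_neg hj₁]
      rw [e]
      have := hw₂ (not_lt.mp hj₁)
      exact X_mul_mem_weightLT (Sum.inl i) (pderiv_mem_weightLT (Sum.inl j) hf) (by omega)

/-- The neighbour of the vertex `k ≠ l` towards `l` in a spanning tree, rooted at `l < n₁`, of the
complete bipartite graph between the vertices below `n₁` and the others: the vertices `k ≥ n₁` are
joined to `l`, and the vertices `k < n₁` other than `l` to a fixed vertex `m ≥ n₁`. -/
def treeNeighbor (n₁ : ℕ) (l m k : Fin n) : Fin n := if n₁ ≤ (k : ℕ) then l else m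

/-- The exponents of the monomials `x_k x_{k'}`, for the edges `k k'` of a spanning tree, are
linearly independent. -/
theorem treeExponents_injective {l m : Fin n} (hl : (l : ℕ) < n₁) (hm : n₁ ≤ (m : ℕ))
    {γ δ : {k : Fin n // k ≠ l} → ℕ}
    (h : ∀ q : Fin n,
      (∑ k, γ k • (Finsupp.single (Sum.inl (k : Fin n)) 1 +
        Finsupp.single (Sum.inl (treeNeighbor n₁ l m k)) 1 : (Fin n ⊕ Fin n) →₀ ℕ)) (Sum.inl q)
      = (∑ k, δ k • (Finsupp.single (Sum.inl (k : Fin n)) 1 +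
        Finsupp.single (Sum.inl (treeNeighbor n₁ l m k)) 1 : (Fin n ⊕ Fin n) →₀ ℕ)) (Sum.inl q)) :
    γ = δ := by
  have hml : m ≠ l := fun e => by rw [e] at hm; omega
  have hcoord : ∀ (γ : {k : Fin n // k ≠ l} → ℕ) (q : Fin n),
      (∑ k, γ k • (Finsupp.single (Sum.inl (k : Fin n)) 1 +
        Finsupp.single (Sum.inl (treeNeighbor n₁ l m k)) 1 : (Fin n ⊕ Fin n) →₀ ℕ)) (Sum.inl q)
      = ∑ k, γ k * ((if (k : Fin n) = q then 1 else 0) +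
          (if treeNeighbor n₁ l m k = q then 1 else 0)) := by
    intro γ q
    rw [Finsupp.finsetSum_apply]
    refine Finset.sum_congr rfl fun k _ => ?_
    simp [Finsupp.single_apply, mul_add]
  simp only [hcoord] at h
  -- A vertex other than `l` and `m` lies on a single edge.
  have hleaf : ∀ (γ : {k : Fin n // k ≠ l} → ℕ) (q : {k : Fin n // k ≠ l}), (q : Fin n) ≠ m →
      ∑ k, γ k * ((if (k : Fin n) = q then 1 else 0) +
          (if treeNeighbor n₁ l m k = q then 1 else 0)) = γ q := by
    intro γ q hq
    rw [Finset.sum_eq_single q]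
    · have : treeNeighbor n₁ l m q ≠ q := by
        unfold treeNeighbor
        split_ifs
        · exact q.2.symm
        · exact hq.symm
      simp [this]
    · intro k _ hk
      have h1 : (k : Fin n) ≠ q := fun e => hk (Subtype.ext e)
      have h2 : treeNeighbor n₁ l m k ≠ q := by
        unfold treeNeighbor
        split_ifs
        · exact q.2.symm
        · exact hq.symm
      simp [h1, h2]
    · simp
  have hne : ∀ q : {k : Fin n // k ≠ l}, (q : Fin n) ≠ m → γ q = δ q := fun q hq => by
    rw [← hleaf γ q hq, ← hleaf δ q hq]
    exact h q
  -- The remaining edge `l m` is recovered from the coordinate at `l`.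
  funext q
  by_cases hq : (q : Fin n) = m
  · have hl' := h l
    rw [← Finset.add_sum_erase _ _ (Finset.mem_univ q),
      ← Finset.add_sum_erase _ _ (Finset.mem_univ q),
      Finset.sum_congr rfl fun k hk => by
        rw [hne k fun e => Finset.ne_of_mem_erase hk (Subtype.ext (e.trans hq.symm))]] at hl'
    have h1 : treeNeighbor n₁ l m q = l := by rw [treeNeighbor, hq, if_pos hm]
    simpa [h1, q.2] using hl'
  · exact hne q hq

variable (h : n₁ ≤ n₂) (l₁ l₂ : ℤ) [Nontrivial (harmonic F n n₁ n₂ h l₁ l₂)]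
  (V : Submodule F (UniversalEnvelopingAlgebra F (sl F n))) (hV : IsGeneratingSpace V)
  (M₀ : Submodule F (harmonic F n n₁ n₂ h l₁ l₂))
  (hM₀ : IsModuleGeneratingSpace
    (envelopingAction F (sl F n) (harmonic F n n₁ n₂ h l₁ l₂)) M₀)

include hV hM₀

theorem le_gkDim_harmonic_of_fintype {κ : Type*} [Fintype κ] (w : Fin n ⊕ Fin n → ℕ)
    (i j : κ → Fin n) (hij : ∀ s, i s ≠ j s) (m : κ → (Fin n ⊕ Fin n) →₀ ℕ) (c : κ → F)
    (hc : ∀ s, c s ≠ 0) (hE : ∀ s, HasSymbol w (E F n₁ n₂ (i s) (j s)) (m s) (c s))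
    (hm : Function.Injective fun γ : κ → ℕ => ∑ s, γ s • m s) :
    ((Fintype.card κ : ℝ) : EReal) ≤
      gkDim (envelopingAction F (sl F n) (harmonic F n n₁ n₂ h l₁ l₂)) V M₀ := by
  let e := (Fintype.equivFin κ).symm
  refine le_gkDim_harmonic F h l₁ l₂ V hV M₀ hM₀ w (i ∘ e) (j ∘ e) (fun s => hij _) (m ∘ e)
    (c ∘ e) (fun s => hc _) (fun s => hE _) fun γ δ hγδ => ?_
  have h1 : ∀ γ : Fin (Fintype.card κ) → ℕ,
      ∑ s, γ s • (m ∘ e) s = ∑ k, (γ ∘ e.symm) k • m k := by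
    intro γ
    rw [← e.sum_comp]
    simp
  have h2 : γ ∘ e.symm = δ ∘ e.symm := hm (by simpa only [h1] using hγδ)
  exact e.symm.surjective.injective_comp_right h2

/-- The root vectors `E_{i,j}` for the edges of a spanning tree have the symbols `-x_i x_j`: the
weights make the `x` variables dominate. -/
theorem pred_le_gkDim_harmonic (h₁ : 0 < n₁) (hn : n₁ < n) :
    (((n - 1 : ℕ) : ℝ) : EReal) ≤
      gkDim (envelopingAction F (sl F n) (harmonic F n n₁ n₂ h l₁ l₂)) V M₀ := by
  let l : Fin n := ⟨0, by omega⟩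
  let m : Fin n := ⟨n₁, hn⟩
  have hl : (l : ℕ) < n₁ := h₁
  have hm : n₁ ≤ (m : ℕ) := le_rfl
  have hcard : Fintype.card {k : Fin n // k ≠ l} = n - 1 := by
    simp [Fintype.card_subtype_compl]
  rw [← hcard]
  let w : Fin n ⊕ Fin n → ℕ := Sum.elim (fun _ => 2) (fun _ => 1)
  refine le_gkDim_harmonic_of_fintype F h l₁ l₂ V hV M₀ hM₀ w
    (fun k => if n₁ ≤ ((k : Fin n) : ℕ) then k else m)
    (fun k => if n₁ ≤ ((k : Fin n) : ℕ) then l else k) (fun k => ?_)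
    (fun k => Finsupp.single (Sum.inl (k : Fin n)) 1 +
      Finsupp.single (Sum.inl (treeNeighbor n₁ l m k)) 1) (fun _ => -1)
    (fun _ => neg_ne_zero.mpr one_ne_zero) (fun k => ?_) fun γ δ hγδ =>
      treeExponents_injective hl hm fun q => DFunLike.congr_fun hγδ (Sum.inl q)
  · intro e
    have := congrArg Fin.val e
    split_ifs at this <;> omega
  · unfold treeNeighbor
    by_cases hk : n₁ ≤ ((k : Fin n) : ℕ)
    · simp only [if_pos hk]
      exact hasSymbol_E_inl F h hl hk (by simp [w])
    · simp only [if_neg hk]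
      rw [add_comm]
      exact hasSymbol_E_inl F h (not_le.mp hk) hm (by simp [w])

/-- One further root vector with symbol `y_b y_d`, next to those for the edges of a spanning
tree. The weights decide which of the two terms of `-x_i x_j + y_i y_j` is the symbol. -/
theorem le_gkDim_harmonic_of_extra (w : Fin n ⊕ Fin n → ℕ) {l m b d : Fin n}
    (hl : (l : ℕ) < n₁) (hm : n₁ ≤ (m : ℕ)) (hd : (d : ℕ) < n₂) (hb : n₂ ≤ (b : ℕ))
    (hw : ∀ i j : Fin n, i = m ∨ j = l →
      w (Sum.inr i) + w (Sum.inr j) < w (Sum.inl i) + w (Sum.inl j))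
    (hw₁ : (d : ℕ) < n₁ → w (Sum.inl b) + w (Sum.inl d) < w (Sum.inr b) + w (Sum.inr d))
    (hw₂ : n₁ ≤ (d : ℕ) → w (Sum.inl b) < w (Sum.inr b) + w (Sum.inr d)) :
    ((n : ℝ) : EReal) ≤
      gkDim (envelopingAction F (sl F n) (harmonic F n n₁ n₂ h l₁ l₂)) V M₀ := by
  have hbd : d ≠ b := fun e => by rw [e] at hd; omega
  have hcard : ((n : ℝ) : EReal) = ((Fintype.card (Fin n) : ℝ) : EReal) := by
    rw [Fintype.card_fin]
  -- The extra root vector is indexed by the root `l` of the tree.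
  let μ : Fin n → (Fin n ⊕ Fin n) →₀ ℕ := fun k =>
    if k = l then Finsupp.single (Sum.inr d) 1 + Finsupp.single (Sum.inr b) 1
    else Finsupp.single (Sum.inl k) 1 + Finsupp.single (Sum.inl (treeNeighbor n₁ l m k)) 1
  refine hcard.le.trans (le_gkDim_harmonic_of_fintype F h l₁ l₂ V hV M₀ hM₀ w
    (fun k => if k = l then b else if n₁ ≤ (k : ℕ) then k else m)
    (fun k => if k = l then d else if n₁ ≤ (k : ℕ) then l else k) (fun k => ?_) μ
    (fun k => if k = l then 1 else -1) (fun k => ?_) (fun k => ?_) fun γ δ hγδ => ?_)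
  · intro e
    have := congrArg Fin.val e
    split_ifs at this <;> omega
  · split_ifs <;> simp
  · by_cases hkl : k = l
    · simp only [μ, if_pos hkl]
      exact hasSymbol_E_inr F h hd hb hw₁ hw₂
    · simp only [μ, if_neg hkl]
      unfold treeNeighbor
      by_cases hk : n₁ ≤ (k : ℕ)
      · simp only [if_pos hk]
        exact hasSymbol_E_inl F h hl hk (hw _ _ (Or.inr rfl))
      · simp only [if_neg hk]
        rw [add_comm]
        exact hasSymbol_E_inl F h (not_le.mp hk) hm (hw _ _ (Or.inl rfl))
  · have hsplit : ∀ γ : Fin n → ℕ, ∑ k, γ k • μ k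
        = γ l • (Finsupp.single (Sum.inr d) 1 + Finsupp.single (Sum.inr b) 1)
          + ∑ k : {k : Fin n // k ≠ l}, γ k • (Finsupp.single (Sum.inl (k : Fin n)) 1 +
            Finsupp.single (Sum.inl (treeNeighbor n₁ l m k)) 1) := by
      intro γ
      rw [Fintype.sum_eq_add_sum_subtype_ne _ l]
      congr 1
      · simp [μ]
      · refine Finset.sum_congr rfl fun k _ => ?_
        simp only [μ, if_neg k.2]
    simp only [hsplit] at hγδ
    have htree : (fun k : {k : Fin n // k ≠ l} => γ k) =
        fun k : {k : Fin n // k ≠ l} => δ k := by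
      refine treeExponents_injective hl hm fun q => ?_
      have := DFunLike.congr_fun hγδ (Sum.inl q)
      simpa using this
    have hext : γ l = δ l := by
      have := DFunLike.congr_fun hγδ (Sum.inr b)
      simpa [hbd] using this
    funext k
    by_cases hkl : k = l
    · rw [hkl, hext]
    · exact congrFun htree ⟨k, hkl⟩

/-- The extra root vector `E_{i,j}` has `i > n₂` and `n₁ < j ≤ n₂`, so that it acts as
`y_i y_j + x_i ∂_{x_j}`. -/
theorem le_gkDim_harmonic_of_lt_of_lt (h₁ : 0 < n₁) (h₁₂ : n₁ < n₂) (hn : n₂ < n) :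
    ((n : ℝ) : EReal) ≤
      gkDim (envelopingAction F (sl F n) (harmonic F n n₁ n₂ h l₁ l₂)) V M₀ := by
  refine le_gkDim_harmonic_of_extra F h l₁ l₂ V hV M₀ hM₀
    -- Here `4 + 4 > 3 + 3` and `3 + 3 > 4`.
    (Sum.elim (fun _ => 4) (fun _ => 3)) (l := ⟨0, by omega⟩) (m := ⟨n₁, by omega⟩)
    (b := ⟨n₂, hn⟩) (d := ⟨n₁, by omega⟩) h₁ le_rfl h₁₂ le_rfl ?_ ?_ ?_
  · simp
  · simp
  · simp

/-- All the root vectors in use act as `-x_i x_j + y_i y_j`. The extra one joins indices `d ≠ l` and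
`b ≠ m`, so that `x_b` and `x_d` can be given small weights: every edge of the tree has `l` or `m` as
an end, and keeps its symbol `-x_i x_j`. -/
theorem le_gkDim_harmonic_of_eq (h₁ : 2 ≤ n₁) (h₁₂ : n₁ = n₂) (hn : n₁ + 2 ≤ n) :
    ((n : ℝ) : EReal) ≤
      gkDim (envelopingAction F (sl F n) (harmonic F n n₁ n₂ h l₁ l₂)) V M₀ := by
  let d : Fin n := ⟨1, by omega⟩
  let b : Fin n := ⟨n₁ + 1, by omega⟩
  -- Among the `y_i y_j` with `i ≠ j`, only `y_b y_d` has a larger weight than `x_i x_j`.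
  refine le_gkDim_harmonic_of_extra F h l₁ l₂ V hV M₀ hM₀
    (Sum.elim (fun k => if k = b ∨ k = d then 1 else 4) (fun _ => 2)) (l := ⟨0, by omega⟩)
    (m := ⟨n₁, by omega⟩) (b := b) (d := d) (by simp; omega) le_rfl (by simp [d]; omega)
    (by simp [b]; omega) ?_ ?_ ?_
  · rintro i j (rfl | rfl)
    · have : ¬((⟨n₁, by omega⟩ : Fin n) = b ∨ (⟨n₁, by omega⟩ : Fin n) = d) := by
        simp [b, d, Fin.ext_iff]
        omega
      simp only [Sum.elim_inl, Sum.elim_inr, if_neg this]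
      split_ifs <;> omega
    · have : ¬((⟨0, by omega⟩ : Fin n) = b ∨ (⟨0, by omega⟩ : Fin n) = d) := by
        simp [b, d, Fin.ext_iff]
      simp only [Sum.elim_inl, Sum.elim_inr, if_neg this]
      split_ifs <;> omega
  · simp
  · simp

end LowerBounds

end Oscillator
end

theorem mainTheorem2 (F : Type*) [Field F] [CharZero F] (n n₁ n₂ : ℕ) (hn : 2 ≤ n)
    (h₁ : 1 ≤ n₁) (h₁₂ : n₁ ≤ n₂) (h₂ : n₂ ≤ n) (l₁ l₂ : ℤ)
    (hirr : LieModule.IsIrreducible F (Oscillator.sl F n)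
      (Oscillator.harmonic F n n₁ n₂ h₁₂ l₁ l₂))
    (V : Submodule F (UniversalEnvelopingAlgebra F (Oscillator.sl F n)))
    (hV : Oscillator.IsGeneratingSpace V)
    (M₀ : Submodule F (Oscillator.harmonic F n n₁ n₂ h₁₂ l₁ l₂))
    (hM₀ : Oscillator.IsModuleGeneratingSpace
      (Oscillator.envelopingAction F (Oscillator.sl F n)
        (Oscillator.harmonic F n n₁ n₂ h₁₂ l₁ l₂)) M₀) :
    Oscillator.gkDim
        (Oscillator.envelopingAction F (Oscillator.sl F n)
          (Oscillator.harmonic F n n₁ n₂ h₁₂ l₁ l₂)) V M₀ = ((n : ℝ) - 1 : ℝ) ↔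
      (n₁ < n₂ ∧ n₂ = n) ∨ (n₁ = 1 ∧ n₂ = 1) ∨ (n₁ = n - 1 ∧ n₂ = n - 1) := by
  have hnontriv : Nontrivial (Oscillator.harmonic F n n₁ n₂ h₁₂ l₁ l₂) :=
    LieModule.nontrivial_of_isIrreducible F (Oscillator.sl F n) _
  have hcast : ((n : ℝ) - 1 : ℝ) = ((n - 1 : ℕ) : ℝ) := by
    rw [Nat.cast_sub (by omega), Nat.cast_one]
  rw [hcast]
  constructor
  · intro heq
    by_contra hcon
    rcases Nat.lt_or_ge n₁ n with hlt | hge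
    · have hle : ((n : ℝ) : EReal) ≤ (((n - 1 : ℕ) : ℝ) : EReal) := by
        rw [← heq]
        rcases Nat.lt_or_ge n₁ n₂ with h12 | h12
        · exact Oscillator.le_gkDim_harmonic_of_lt_of_lt F h₁₂ l₁ l₂ V hV M₀ hM₀ h₁ h12 (by omega)
        · exact Oscillator.le_gkDim_harmonic_of_eq F h₁₂ l₁ l₂ V hV M₀ hM₀ (by omega)
            (by omega) (by omega)
      have : n ≤ n - 1 := by exact_mod_cast EReal.coe_le_coe_iff.mp hle
      omega
    · have hle := Oscillator.gkDim_harmonic_le_zero F h₁₂ l₁ l₂ V hV M₀ hM₀ (by omega) (by omega)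
      rw [heq] at hle
      have : n - 1 ≤ 0 := by exact_mod_cast EReal.coe_le_coe_iff.mp hle
      omega
  · intro hcases
    refine le_antisymm ?_ (Oscillator.pred_le_gkDim_harmonic F h₁₂ l₁ l₂ V hV M₀ hM₀ h₁ (by omega))
    rcases hcases with ⟨-, h⟩ | ⟨h, h'⟩ | ⟨h, h'⟩
    · exact Oscillator.gkDim_harmonic_le_of_eq F h₁₂ l₁ l₂ V hV M₀ hM₀ (by omega) h
    · exact Oscillator.gkDim_harmonic_le_of_one F h₁₂ l₁ l₂ V hV M₀ hM₀ (by omega) h h'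
    · exact Oscillator.gkDim_harmonic_le_of_pred F h₁₂ l₁ l₂ V hV M₀ hM₀ (by omega) h h'
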